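/- **Setting.** Let $\widehat F(\omega)=\int F(t)e^{-2\pi i t\cdot\omega}\,dt$ (extended to $L^2$ by Plancherel), $T_xF(t)=F(t-x)$, and $\langle F,G\rangle=\int F\overline G$. For $1\le p\le\infty$ let $W(L^p,\ell^1)$ be the space of measurable $F:\mathbb R^m\to\mathbb C$ with $\sum_{k\in\mathbb Z^m}\|F\mathbf 1_{k+[0,1]^m}\|_p<\infty$. Let $\mathcal D$ be the set of all $f\in L^2(\mathbb R^m)$ such that $\widehat f\in W(L^\infty,\ell^1)$ and $\widehat f$ has compact support. A bounded continuous $F:\mathbb R^m\to\mathbb C$ is almost periodic if for every $\varepsilon>0$ the set of $\tau$ with $\sup_t|F(t+\tau)-F(t)|\le\varepsilon$ meets all cubes of some fixed side length. The Fourier coefficient of such an $F$ at $\omega\in\mathbb R^m$ is $\lim_{R\to\infty}R^{-m}\int_{x+[0,R]^m}F(t)e^{2\pi i\omega\cdot t}\,dt$ (the limit does not depend on $x\in\mathbb R^m$). Let $\Gamma\subset\mathbb R^m\times\mathbb R$ be a lattice (discrete, of full rank) such that the coordinate projections $p_1:\Gamma\to\mathbb R^m$ and $p_2:\Gamma\to\mathbb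 R$ are both injective with dense image. Let $\mathrm{vol}(\Gamma)$ be its covolume, $\Gamma^*=\{\eta\in\mathbb R^m\times\mathbb R:\gamma\cdot\eta\in\mathbb Z\ \text{for all}\ \gamma\in\Gamma\}$ its dual lattice, and $p_1^*(\eta)\in\mathbb R^m$, $p_2^*(\eta)\in\mathbb R$ the two coordinates of $\eta\in\Gamma^*$. Let $\Omega\subset\mathbb R$ be a compact interval, symmetric around the origin, that is the closure of its interior, and let $\Lambda(\Omega)=\{p_1(\gamma):\gamma\in\Gamma,\ p_2(\gamma)\in\Omega\}$ be the associated simple model set. For a smooth function $\psi:\mathbb R\to\mathbb R$ with support in $\Omega$, put $w_\psi(\lambda)=\psi(p_2(\gamma))$ for $\lambda=p_1(\gamma)\in\Lambda(\Omega)$. **Proposition 3.5.** Let $\Gamma$, $\Omega$ and $\Lambda(\Omega)$ be as above, and let $\psi\ge 0$ be smooth with support in $\Omega$. Let $\mathcal K$ be a countable index set, let $g_k,h_k\in W(L^2,\ell^1)$ for $k\in\mathcal K$, and suppose that for some constants $B_g,B_h>0$ $$\sum_{k\in\mathcal K}|\widehat g_k(t)|^2\le B_g,\qquad \sum_{k\in\mathcal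 K}|\widehat h_k(t)|^2\le B_h\qquad\text{for all } t\in\mathbb R^m .$$ Then, for every $f\in\mathcal D$, the series $$\mathcal N^\psi(x)=\sum_{k\in\mathcal K}\sum_{\lambda\in\Lambda(\Omega)}w_\psi(\lambda)^2\,\langle T_xf,T_\lambda g_k\rangle\,\langle T_\lambda h_k,T_xf\rangle$$ converges absolutely for every $x\in\mathbb R^m$, and $\mathcal N^\psi$ is almost periodic. For every $\eta\in\Gamma^*$, its Fourier coefficient at $p_1^*(\eta)$ is $$\widehat{\mathcal N}^\psi(\eta)=\mathrm{vol}(\Gamma)^{-1}\,\widehat{\psi^2}\bigl(p_2^*(\eta)\bigr)\int_{\mathbb R^m}\widehat f(t)\,\overline{\widehat f(t-p_1^*(\eta))}\Bigl(\sum_{k\in\mathcal K}\overline{\widehat g_k(t)}\,\widehat h_k(t-p_1^*(\eta))\Bigr)dt ,$$ where $\widehat{\psi^2}$ is the Fourier transform of $\psi^2$, and the sum over $k$ (for every $t$) and the integral converge absolutely; its Fourier coefficients at all $\omega\notin p_1^*(\Gamma^*)$ are $0$. Moreover $\mathcal N^\psi$ coincides pointwise with its Fourier series: for every $x\in\mathbb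 R^m$, $$\mathcal N^\psi(x)=\sum_{\eta\in\Gamma^*}\widehat{\mathcal N}^\psi(\eta)\,e^{-2\pi i\,p_1^*(\eta)\cdot x}\qquad\text{with absolute convergence.}$$ -/

import Mathlib

open MeasureTheory Filter Topology
open scoped ENNReal FourierTransform ComplexConjugate

noncomputable section

namespace ModelSetFrames

/-- The closed cube `B(x, R) = R[0,1]^m + x`. -/
def box {m : ℕ} (x : EuclideanSpace ℝ (Fin m)) (R : ℝ) : Set (EuclideanSpace ℝ (Fin m)) :=
  {y | ∀ i, x i ≤ y i ∧ y i ≤ x i + R}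

/-! ### Almost periodic functions -/

/-- `D` is relatively dense: all cubes of some fixed side length meet `D`. -/
def RelativelyDense {m : ℕ} (D : Set (EuclideanSpace ℝ (Fin m))) : Prop :=
  ∃ r : ℝ, 0 < r ∧ ∀ t, (D ∩ box t r).Nonempty

/-- Bohr almost periodicity of a bounded continuous function `ℝ^m → ℂ`. -/
structure AlmostPeriodic {m : ℕ} (F : EuclideanSpace ℝ (Fin m) → ℂ) : Prop where
  continuous : Continuous F
  bounded : ∃ C : ℝ, ∀ t, ‖F t‖ ≤ C
  exists_almost_periods : ∀ ε : ℝ, 0 < ε →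
    ∃ D : Set (EuclideanSpace ℝ (Fin m)), RelativelyDense D ∧
      ∀ τ ∈ D, ∀ t, ‖F (t + τ) - F t‖ ≤ ε

/-- The mean value of `F` exists and equals `a`: the averages over `B(x, R)` tend to `a` as
`R → ∞`, for every `x`. -/
def HasMean {m : ℕ} (F : EuclideanSpace ℝ (Fin m) → ℂ) (a : ℂ) : Prop :=
  ∀ x, Tendsto (fun R : ℝ => ((R : ℂ) ^ m)⁻¹ * ∫ t in box x R, F t) atTop (𝓝 a)

/-- The character `e^{2 π i ω · t}`. -/
def character {m : ℕ} (ω t : EuclideanSpace ℝ (Fin m)) : ℂ :=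
  Complex.exp (2 * Real.pi * Complex.I * (inner ℝ ω t : ℝ))

/-- The Fourier coefficient of the almost periodic function `F` at the frequency `ω`, that is the
mean value of `F(t) e^{2 π i ω · t}`, exists and equals `a`. -/
def HasFourierCoeff {m : ℕ} (F : EuclideanSpace ℝ (Fin m) → ℂ)
    (ω : EuclideanSpace ℝ (Fin m)) (a : ℂ) : Prop :=
  HasMean (fun t => F t * character ω t) a

/-! ### Function spaces -/

/-- The norm of the Wiener amalgam space `W(L^p, ℓ^1)`: the sum over `k ∈ ℤ^m` of the `L^p` norms
of the restrictions to the unit cubes `[0,1]^m + k`. -/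
def wienerNorm {m : ℕ} (p : ℝ≥0∞) (F : EuclideanSpace ℝ (Fin m) → ℂ) : ℝ≥0∞ :=
  ∑' k : Fin m → ℤ,
    eLpNorm ((box (WithLp.toLp 2 fun i => (k i : ℝ)) 1).indicator F) p volume

/-- Membership in the Wiener amalgam space `W(L^p, ℓ^1)`. -/
def MemWiener {m : ℕ} (p : ℝ≥0∞) (F : EuclideanSpace ℝ (Fin m) → ℂ) : Prop :=
  AEStronglyMeasurable F volume ∧ wienerNorm p F < ∞

/-- The Hilbert space `L²(ℝ^m)`. -/
abbrev L2 (m : ℕ) : Type :=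
  Lp ℂ 2 (volume : Measure (EuclideanSpace ℝ (Fin m)))

/-- (A representative of) the Plancherel Fourier transform `f̂` of `f ∈ L²(ℝ^m)`. -/
def fourierL2 {m : ℕ} (f : L2 m) : EuclideanSpace ℝ (Fin m) → ℂ :=
  (𝓕 f : L2 m)

/-- The space `𝒟` of all `f ∈ L²(ℝ^m)` whose (Plancherel) Fourier transform belongs to
`W(L^∞, ℓ^1)` and has compact support. As `𝓕 f` is a class of functions modulo null sets, the
support is understood in the essential sense. -/
def MemD {m : ℕ} (f : L2 m) : Prop :=
  MemWiener ∞ (fourierL2 f) ∧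
    ∃ K : Set (EuclideanSpace ℝ (Fin m)), IsCompact K ∧
      ∀ᵐ t, t ∉ K → fourierL2 f t = 0

/-- Translation `T_x f (t) = f (t - x)`. -/
def translate {m : ℕ} (x : EuclideanSpace ℝ (Fin m)) (F : EuclideanSpace ℝ (Fin m) → ℂ) :
    EuclideanSpace ℝ (Fin m) → ℂ :=
  fun t => F (t - x)

/-- The `L²` inner product, linear in the first argument. -/
def l2Inner {m : ℕ} (F G : EuclideanSpace ℝ (Fin m) → ℂ) : ℂ :=
  ∫ t, F t * conj (G t)

/-! ### Simple model sets -/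

/-- The requirements on a lattice `Γ ⊆ ℝ^m × ℝ` in the construction of model sets (that `Γ` is a
lattice is expressed by `DiscreteTopology Γ` and `IsZLattice ℝ Γ`): both coordinate projections
are injective on `Γ` and have dense image. -/
structure IsCutAndProject {m : ℕ} (Γ : Submodule ℤ (EuclideanSpace ℝ (Fin m) × ℝ)) : Prop where
  injOn_fst : Set.InjOn Prod.fst (Γ : Set (EuclideanSpace ℝ (Fin m) × ℝ))
  injOn_snd : Set.InjOn Prod.snd (Γ : Set (EuclideanSpace ℝ (Fin m) × ℝ))
  dense_fst : Dense (Prod.fst '' (Γ : Set (EuclideanSpace ℝ (Fin m) × ℝ)))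
  dense_snd : Dense (Prod.snd '' (Γ : Set (EuclideanSpace ℝ (Fin m) × ℝ)))

/-- A window of a simple model set that is symmetric around the origin: a compact interval that
is the closure of its interior, with boundary of measure zero, and `-Ω = Ω`. -/
structure IsSymmetricSimpleWindow (Ω : Set ℝ) : Prop where
  isCompact : IsCompact Ω
  closure_interior : closure (interior Ω) = Ω
  volume_frontier : volume (frontier Ω) = 0
  interval : Ω.OrdConnected
  symmetric : ∀ s ∈ Ω, -s ∈ Ω

/-- The dual lattice `Γ* = {η : γ · η ∈ ℤ for all γ ∈ Γ}` for the Euclidean inner product of the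
orthogonal sum `ℝ^m × ℝ`. -/
def dualLattice {m : ℕ} (Γ : Submodule ℤ (EuclideanSpace ℝ (Fin m) × ℝ)) :
    Set (EuclideanSpace ℝ (Fin m) × ℝ) :=
  {η | ∀ γ ∈ Γ, ∃ n : ℤ, inner ℝ γ.1 η.1 + γ.2 * η.2 = n}

/-- The model set `Λ(Ω) = {p₁(γ) : γ ∈ Γ, p₂(γ) ∈ Ω}`. -/
def modelSet {m : ℕ} (Γ : Submodule ℤ (EuclideanSpace ℝ (Fin m) × ℝ)) (Ω : Set ℝ) :
    Set (EuclideanSpace ℝ (Fin m)) :=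
  {l | ∃ γ ∈ Γ, γ.2 ∈ Ω ∧ γ.1 = l}

open Classical in
/-- The weight `w_ψ(λ) = ψ(p₂(γ))` for `λ = p₁(γ) ∈ Λ(Ω)`, and `w_ψ(λ) = 0` for `λ ∉ Λ(Ω)`.
The point `γ` is unique, since `p₁` is injective on `Γ`. -/
def weight {m : ℕ} (Γ : Submodule ℤ (EuclideanSpace ℝ (Fin m) × ℝ)) (Ω : Set ℝ) (ψ : ℝ → ℝ)
    (l : EuclideanSpace ℝ (Fin m)) : ℝ :=
  if h : l ∈ modelSet Γ Ω then ψ h.choose.2 else 0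

theorem weight_fst {m : ℕ} {Γ : Submodule ℤ (EuclideanSpace ℝ (Fin m) × ℝ)}
    (hΓ : IsCutAndProject Γ) {Ω : Set ℝ} {ψ : ℝ → ℝ} {γ : EuclideanSpace ℝ (Fin m) × ℝ}
    (hγ : γ ∈ Γ) (hγΩ : γ.2 ∈ Ω) : weight Γ Ω ψ γ.1 = ψ γ.2 := by
  have h : γ.1 ∈ modelSet Γ Ω := ⟨γ, hγ, hγΩ, rfl⟩
  have hc := h.choose_spec
  rw [weight, dif_pos h, hΓ.injOn_fst hc.1 hγ hc.2.2]

/-- The space `C₀^∞(Ω)` of real-valued smooth functions on `ℝ` with support in `Ω`. -/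
structure IsSmoothSupportedIn (ψ : ℝ → ℝ) (Ω : Set ℝ) : Prop where
  contDiff : ContDiff ℝ ((⊤ : ℕ∞) : WithTop ℕ∞) ψ
  tsupport_subset : tsupport ψ ⊆ Ω

/-! ### The weighted function and its coefficients -/

/-- The term of index `(k, l)` of the series defining `𝒩^ψ(x)`, for `g = g_k` and `h = h_k`:
`w_ψ(l)² ⟨T_x f, T_l g⟩ ⟨T_l h, T_x f⟩`. -/
def seriesTerm {m : ℕ} (Γ : Submodule ℤ (EuclideanSpace ℝ (Fin m) × ℝ)) (Ω : Set ℝ) (ψ : ℝ → ℝ)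
    (f g h : EuclideanSpace ℝ (Fin m) → ℂ) (x l : EuclideanSpace ℝ (Fin m)) : ℂ :=
  ((weight Γ Ω ψ l ^ 2 : ℝ) : ℂ) * l2Inner (translate x f) (translate l g) *
    l2Inner (translate l h) (translate x f)

/-- The function
`𝒩^ψ(x) = ∑_k ∑_{l ∈ Λ(Ω)} w_ψ(l)² ⟨T_x f, T_l g_k⟩ ⟨T_l h_k, T_x f⟩`. -/
def weightedFun {m : ℕ} {K : Type*} (Γ : Submodule ℤ (EuclideanSpace ℝ (Fin m) × ℝ))
    (Ω : Set ℝ) (ψ : ℝ → ℝ) (f : EuclideanSpace ℝ (Fin m) → ℂ)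
    (g h : K → EuclideanSpace ℝ (Fin m) → ℂ) (x : EuclideanSpace ℝ (Fin m)) : ℂ :=
  ∑' k : K, ∑' l : modelSet Γ Ω, seriesTerm Γ Ω ψ f (g k) (h k) x l

/-- The integrand
`f̂(t) conj(f̂(t - ω)) ∑_k conj(ĝ_k(t)) ĥ_k(t - ω)`, where `fhat` stands for `f̂`. -/
def coeffIntegrand {m : ℕ} {K : Type*} (fhat : EuclideanSpace ℝ (Fin m) → ℂ)
    (g h : K → EuclideanSpace ℝ (Fin m) → ℂ) (ω t : EuclideanSpace ℝ (Fin m)) : ℂ :=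
  fhat t * conj (fhat (t - ω)) * ∑' k : K, conj (𝓕 (g k) t) * 𝓕 (h k) (t - ω)

/-- The coefficient
`vol(Γ)⁻¹ (ψ²)^(p₂*(η)) ∫ f̂(t) conj(f̂(t - p₁*(η))) ∑_k conj(ĝ_k(t)) ĥ_k(t - p₁*(η)) dt`,
where `(ψ²)^` is the Fourier transform of the function `ψ²`. -/
def coeff {m : ℕ} {K : Type*} (Γ : Submodule ℤ (EuclideanSpace ℝ (Fin m) × ℝ)) (ψ : ℝ → ℝ)
    (fhat : EuclideanSpace ℝ (Fin m) → ℂ) (g h : K → EuclideanSpace ℝ (Fin m) → ℂ)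
    (η : EuclideanSpace ℝ (Fin m) × ℝ) : ℂ :=
  ((ZLattice.covolume Γ volume : ℝ) : ℂ)⁻¹ * 𝓕 (fun s : ℝ => ((ψ s ^ 2 : ℝ) : ℂ)) η.2 *
    ∫ t, coeffIntegrand fhat g h η.1 t

end ModelSetFrames

end

/-!
The inner product `⟨T_x f, T_λ g_k⟩` is the inverse Fourier transform of `f̂ · conj ĝ_k` at `λ - x`,
and `f̂` is compactly supported. Hence `𝒩^ψ(x)` is the sum over `γ ∈ Γ` of `F(γ - (x, 0))`, where
`F(y, s)` is `ψ(s)²` times a sum over `k` of products of two band-limited functions of `y`, and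
Poisson summation over `Γ` turns it into a series over `Γ*` with frequencies `p₁*(η)`. Sampling
inequalities for band-limited functions give local summability of the translates of `F`, uniformly
over finite sets of `k` by `∑ₖ |ĝ_k|² ≤ B_g`. On the dual side, the correlation of the two
spectra is a bounded function supported in a compact set of `p₁*(η)`, and the Fourier transform of
`ψ²` decays rapidly, so the series over `Γ*` converges absolutely. Almost periodicity and the
Fourier coefficients are read off this series, because `p₁*` is injective on `Γ*` as soon as
`p₂(Γ)` is dense.
-/

noncomputable section

namespace ModelSetFrames

open Module

/-! ### Poisson summation for lattices -/

section LocallySummable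

variable {V : Type*} [NormedAddCommGroup V] {E : Type*} [NormedAddCommGroup E]

/-- The sums of `‖F‖` over the translates of the lattice `L` converge uniformly on bounded sets.
This is the decay under which Poisson summation is carried out. -/
def LocallySummable (L : Submodule ℤ V) (F : V → E) : Prop :=
  ∀ R : ℝ, ∃ c : L → ℝ, Summable c ∧ ∀ (γ : L) (v : V), ‖v‖ ≤ R → ‖F (v + γ)‖ ≤ c γ

variable {L : Submodule ℤ V} {F : V → E}

theorem LocallySummable.congr_norm {E' : Type*} [NormedAddCommGroup E'] {G : V → E'}
    (h : LocallySummable L F) (hG : ∀ v, ‖G v‖ = ‖F v‖) : LocallySummable L G := by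
  simpa only [LocallySummable, hG] using h

theorem LocallySummable.continuous_tsum [CompleteSpace E] (h : LocallySummable L F)
    (hF : Continuous F) : Continuous fun v => ∑' γ : L, F (v + γ) := by
  refine continuous_iff_continuousAt.2 fun v₀ => ?_
  obtain ⟨c, hc, hcF⟩ := h (‖v₀‖ + 1)
  have hball : ContinuousOn (fun v => ∑' γ : L, F (v + γ)) (Metric.closedBall v₀ 1) :=
    continuousOn_tsum (fun γ => by fun_prop) hc fun γ v hv =>
      hcF γ v (norm_le_of_mem_closedBall hv)
  exact hball.continuousAt (Metric.closedBall_mem_nhds v₀ one_pos)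

theorem LocallySummable.tsum_setLIntegral_lt_top [MeasurableSpace V] (h : LocallySummable L F)
    {s : Set V} (hs : Bornology.IsBounded s) {μ : Measure V} (hμ : μ s < ∞) :
    ∑' γ : L, ∫⁻ v in s, ‖F (v + γ)‖ₑ ∂μ < ∞ := by
  obtain ⟨R, hR, hsR⟩ := hs.exists_pos_norm_le
  obtain ⟨c, hc, hcF⟩ := h R
  have hc0 : ∀ γ, 0 ≤ c γ := fun γ => (norm_nonneg _).trans (hcF γ 0 (by simpa using hR.le))
  calc ∑' γ : L, ∫⁻ v in s, ‖F (v + γ)‖ₑ ∂μ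
      ≤ ∑' γ : L, ENNReal.ofReal (c γ) * μ s := by
        refine ENNReal.tsum_le_tsum fun γ => ?_
        rw [← setLIntegral_const]
        refine setLIntegral_mono measurable_const fun v hv => ?_
        rw [← ofReal_norm]
        exact ENNReal.ofReal_le_ofReal (hcF γ v (hsR v hv))
    _ = ENNReal.ofReal (∑' γ : L, c γ) * μ s := by
        rw [ENNReal.tsum_mul_right, ENNReal.ofReal_tsum_of_nonneg hc0 hc]
    _ < ∞ := ENNReal.mul_lt_top ENNReal.ofReal_lt_top hμ

variable [MeasurableSpace V] [BorelSpace V]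

instance measurableVAdd_submodule : MeasurableVAdd L V :=
  inferInstanceAs (MeasurableVAdd L.toAddSubgroup V)

instance vaddInvariantMeasure_submodule (μ : Measure V) [μ.IsAddLeftInvariant] :
    VAddInvariantMeasure L V μ :=
  inferInstanceAs (VAddInvariantMeasure L.toAddSubgroup V μ)

variable [NormedSpace ℝ V] [FiniteDimensional ℝ V] [DiscreteTopology L] [IsZLattice ℝ L]
  (μ : Measure V) [μ.IsAddHaarMeasure]

theorem LocallySummable.integrable (h : LocallySummable L F) (hF : Continuous F) :
    Integrable F μ := by
  have : Module.Finite ℤ L := ZLattice.module_finite ℝ L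
  have : Module.Free ℤ L := ZLattice.module_free ℝ L
  have hV := ZSpan.fundamentalDomain_isBounded ((Free.chooseBasis ℤ L).ofZLatticeBasis ℝ)
  have hD := ZLattice.isAddFundamentalDomain (Free.chooseBasis ℤ L) μ
  refine ⟨hF.aestronglyMeasurable, ?_⟩
  rw [HasFiniteIntegral, hD.lintegral_eq_tsum'' (fun x => ‖F x‖ₑ)]
  simpa only [Submodule.vadd_def, vadd_eq_add, add_comm] using
    h.tsum_setLIntegral_lt_top hV hV.measure_lt_top

theorem LocallySummable.setIntegral_tsum [NormedSpace ℝ E] (h : LocallySummable L F)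
    (hF : Continuous F) {ι : Type*} [Finite ι] (b : Basis ι ℤ L) :
    ∫ v in ZSpan.fundamentalDomain (b.ofZLatticeBasis ℝ), ∑' γ : L, F (v + γ) ∂μ
      = ∫ v, F v ∂μ := by
  have hV := ZSpan.fundamentalDomain_isBounded (b.ofZLatticeBasis ℝ)
  have hD := ZLattice.isAddFundamentalDomain b μ
  rw [hD.integral_eq_tsum'' _ (h.integrable μ hF), integral_tsum
    (fun γ : L => (by fun_prop : Continuous fun v => F (v + γ)).aestronglyMeasurable)
    (h.tsum_setLIntegral_lt_top hV hV.measure_lt_top).ne]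
  simp only [Submodule.vadd_def, vadd_eq_add, add_comm]

end LocallySummable

section UnitCube

variable {ι : Type*}

theorem exists_continuousMap_unitAddTorus [Finite ι] {f : (ι → ℝ) → ℂ} (hf : Continuous f)
    (hper : ∀ x (k : ι → ℤ), f (x + fun i => (k i : ℝ)) = f x) :
    ∃ Q : C(UnitAddTorus ι, ℂ), ∀ x, Q (fun i => (x i : UnitAddCircle)) = f x := by
  let π : C(ι → ℝ, UnitAddTorus ι) := ⟨fun x i => (x i : UnitAddCircle), by fun_prop⟩
  have hπ : IsOpenQuotientMap π :=
    ⟨fun t => ⟨fun i => (t i).out, funext fun i => Quotient.out_eq' (t i)⟩, π.continuous,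
      IsOpenMap.piMap (fun _ => QuotientAddGroup.isOpenMap_coe) (by simp)⟩
  have hfactor : Function.FactorsThrough f π := by
    intro x y hxy
    have hint : ∀ i, ∃ k : ℤ, x i = y i + k := fun i => by
      have hi : (x i : UnitAddCircle) = y i := congrFun hxy i
      obtain ⟨k, hk⟩ := AddCircle.coe_eq_zero_iff (1 : ℝ) |>.1 (by
        rw [AddCircle.coe_sub, hi, sub_self] : ((x i - y i : ℝ) : UnitAddCircle) = 0)
      exact ⟨k, by rw [zsmul_one] at hk; linarith⟩
    choose k hk using hint
    rw [show x = y + fun i => (k i : ℝ) from funext hk, hper]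
  refine ⟨hπ.isQuotientMap.lift ⟨f, hf⟩ hfactor, fun x => ?_⟩
  exact DFunLike.congr_fun (hπ.isQuotientMap.lift_comp ⟨f, hf⟩ hfactor) x

variable [Fintype ι]

theorem mFourier_coe (n : ι → ℤ) (x : ι → ℝ) :
    UnitAddTorus.mFourier n (fun i => (x i : UnitAddCircle)) = 𝐞 (∑ i, n i * x i) := by
  simp only [UnitAddTorus.mFourier, ContinuousMap.coe_mk, fourier_coe_apply,
    Real.fourierChar_apply, ← Complex.exp_sum]
  push_cast
  simp only [Finset.mul_sum, Finset.sum_mul]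
  congr! 2
  ring

theorem mFourierCoeff_eq_setIntegral_Ico {Q : UnitAddTorus ι → ℂ} (n : ι → ℤ) :
    UnitAddTorus.mFourierCoeff Q n = ∫ x in Set.univ.pi fun _ : ι => Set.Ico (0 : ℝ) 1,
      𝐞 (-∑ i, n i * x i) • Q (fun i => (x i : UnitAddCircle)) := by
  have hcube : {x : ι → ℝ | ∀ i, x i ∈ Set.Ioc ((0 : ι → ℝ) i) ((0 : ι → ℝ) i + 1)}
      =ᵐ[volume] Set.univ.pi fun _ : ι => Set.Ico (0 : ℝ) 1 := by
    have hIoc : {x : ι → ℝ | ∀ i, x i ∈ Set.Ioc ((0 : ι → ℝ) i) ((0 : ι → ℝ) i + 1)}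
        = Set.univ.pi fun _ : ι => Set.Ioc (0 : ℝ) 1 := by
      ext; simp
    rw [hIoc]
    exact (Measure.univ_pi_Ioc_ae_eq_Icc (f := fun _ => 0) (g := fun _ => 1)).trans
      Measure.univ_pi_Ico_ae_eq_Icc.symm
  rw [UnitAddTorus.mFourierCoeff_eq_integral _ n 0, setIntegral_congr_set hcube]
  simp only [mFourier_coe, Pi.neg_apply, Int.cast_neg, neg_mul, Finset.sum_neg_distrib,
    Circle.smul_def]

theorem hasSum_setIntegral_Ico_of_periodic {f : (ι → ℝ) → ℂ} (hf : Continuous f)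
    (hper : ∀ x (k : ι → ℤ), f (x + fun i => (k i : ℝ)) = f x)
    (hs : Summable fun n : ι → ℤ => ∫ x in Set.univ.pi fun _ : ι => Set.Ico (0 : ℝ) 1,
      𝐞 (-∑ i, n i * x i) • f x) :
    HasSum (fun n : ι → ℤ => ∫ x in Set.univ.pi fun _ : ι => Set.Ico (0 : ℝ) 1,
      𝐞 (-∑ i, n i * x i) • f x) (f 0) := by
  obtain ⟨Q, hQ⟩ := exists_continuousMap_unitAddTorus hf hper
  have hcoeff : UnitAddTorus.mFourierCoeff Q = fun n : ι → ℤ =>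
      ∫ x in Set.univ.pi fun _ : ι => Set.Ico (0 : ℝ) 1, 𝐞 (-∑ i, n i * x i) • f x := by
    funext n
    simp only [mFourierCoeff_eq_setIntegral_Ico, hQ]
  rw [← hcoeff] at hs ⊢
  have hsum := UnitAddTorus.hasSum_mFourier_series_apply_of_summable hs
    (fun i => ((0 : ι → ℝ) i : UnitAddCircle))
  rw [hQ] at hsum
  simpa only [mFourier_coe, Pi.zero_apply, mul_zero, Finset.sum_const_zero,
    AddChar.map_zero_eq_one, Circle.coe_one, smul_eq_mul, mul_one] using hsum

end UnitCube

section DualSubmodule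

variable {V : Type*} [NormedAddCommGroup V] [NormedSpace ℝ V] [FiniteDimensional ℝ V]
  {L : Submodule ℤ V} [DiscreteTopology L] [IsZLattice ℝ L]
  {β : LinearMap.BilinForm ℝ V}

theorem dualSubmodule_eq_span_dualBasis {ι : Type*} [Finite ι] [DecidableEq ι]
    (hβ : β.Nondegenerate) (b : Basis ι ℤ L) :
    β.dualSubmodule L
      = Submodule.span ℤ (Set.range (β.dualBasis hβ (b.ofZLatticeBasis ℝ))) := by
  rw [← LinearMap.BilinForm.dualSubmodule_span_of_basis β hβ,
    Basis.ofZLatticeBasis_span ℝ L b]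

theorem exists_dualSubmodule_eq_span (hβ : β.Nondegenerate) :
    ∃ b : Basis (Free.ChooseBasisIndex ℤ L) ℝ V,
      β.dualSubmodule L = Submodule.span ℤ (Set.range b) := by
  classical
  have : Module.Finite ℤ L := ZLattice.module_finite ℝ L
  have : Module.Free ℤ L := ZLattice.module_free ℝ L
  exact ⟨_, dualSubmodule_eq_span_dualBasis hβ (Free.chooseBasis ℤ L)⟩

theorem discreteTopology_dualSubmodule (hβ : β.Nondegenerate) :
    DiscreteTopology (β.dualSubmodule L) := by
  have : Module.Finite ℤ L := ZLattice.module_finite ℝ L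
  obtain ⟨b, hb⟩ := exists_dualSubmodule_eq_span (L := L) hβ
  rw [hb]
  infer_instance

theorem exists_equiv_dualSubmodule {ι : Type*} [Fintype ι] (hβ : β.Nondegenerate)
    (b : Basis ι ℤ L) :
    ∃ e : (ι → ℤ) ≃ β.dualSubmodule L,
      ∀ n v, β (e n) v = ∑ i, n i * (b.ofZLatticeBasis ℝ).repr v i := by
  classical
  set B := b.ofZLatticeBasis ℝ
  refine ⟨((β.dualBasis hβ B).restrictScalars ℤ).equivFun.symm.toEquiv.trans
    (LinearEquiv.ofEq _ _ (dualSubmodule_eq_span_dualBasis hβ b).symm).toEquiv, fun n v => ?_⟩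
  have hcoord : ∀ i, β (β.dualBasis hβ B i) v = B.repr v i := fun i => by
    conv_lhs => rw [← B.sum_repr v]
    simp only [map_sum, map_smul, LinearMap.BilinForm.apply_dualBasis_left, smul_eq_mul, mul_ite,
      mul_one, mul_zero, Finset.sum_ite_eq', Finset.mem_univ, if_true]
  simp [Basis.equivFun_symm_apply, LinearMap.sum_apply, hcoord, ← Int.cast_smul_eq_zsmul ℝ]

end DualSubmodule

section Coordinates

variable {V : Type*} [NormedAddCommGroup V] [NormedSpace ℝ V] {ι : Type*}

theorem repr_equivFunL_symm [Finite ι] (B : Basis ι ℝ V) (c : ι → ℝ) (i : ι) :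
    B.repr (B.equivFunL.symm c) i = c i :=
  congrFun (B.equivFun.apply_symm_apply c) i

theorem equivFunL_symm_preimage_fundamentalDomain [Finite ι] (B : Basis ι ℝ V) :
    B.equivFunL.symm ⁻¹' ZSpan.fundamentalDomain B
      = Set.univ.pi fun _ : ι => Set.Ico (0 : ℝ) 1 := by
  ext c
  simp [ZSpan.mem_fundamentalDomain, repr_equivFunL_symm]

variable [FiniteDimensional ℝ V] {L : Submodule ℤ V} [DiscreteTopology L] [IsZLattice ℝ L]
  (b : Basis ι ℤ L)

theorem equivFunL_symm_intCast [Fintype ι] (k : ι → ℤ) :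
    (b.ofZLatticeBasis ℝ).equivFunL.symm (fun i => (k i : ℝ)) = (∑ i, k i • b i : L) := by
  refine ((b.ofZLatticeBasis ℝ).equivFun_symm_apply _).trans ?_
  simp [Int.cast_smul_eq_zsmul]

variable [MeasurableSpace V] [BorelSpace V] (μ : Measure V) [μ.IsAddHaarMeasure]

theorem measurePreserving_equivFunL_symm [Fintype ι] :
    MeasurePreserving (b.ofZLatticeBasis ℝ).equivFunL.symm volume
      ((ENNReal.ofReal (ZLattice.covolume L μ))⁻¹ • μ) := by
  set B := b.ofZLatticeBasis ℝ
  set ν := Measure.map B.equivFunL.symm volume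
  have hcont : Continuous B.equivFunL.symm := B.equivFunL.symm.continuous
  have hν : ν.IsAddHaarMeasure := B.equivFunL.symm.isAddHaarMeasure_map volume
  have hν_cell : ν (ZSpan.fundamentalDomain B) = 1 := by
    rw [Measure.map_apply hcont.measurable (ZSpan.fundamentalDomain_measurableSet B),
      equivFunL_symm_preimage_fundamentalDomain, Real.volume_pi_Ico]
    simp
  have hμ_cell : ENNReal.ofReal (ZLattice.covolume L μ) = μ (ZSpan.fundamentalDomain B) := by
    rw [ZLattice.covolume_eq_measure_fundamentalDomain L μ (ZLattice.isAddFundamentalDomain b μ),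
      Measure.real, ENNReal.ofReal_toReal
        (ZSpan.fundamentalDomain_isBounded B).measure_lt_top.ne]
  have hscale : ν = Measure.addHaarScalarFactor ν μ • μ :=
    Measure.isAddLeftInvariant_eq_smul ν μ
  rw [hscale, Measure.smul_apply] at hν_cell
  refine ⟨hcont.measurable, ?_⟩
  change ν = _
  rw [hscale, hμ_cell, ← ENNReal.eq_inv_of_mul_eq_one_left
    (by simpa only [ENNReal.smul_def, smul_eq_mul] using hν_cell)]
  rfl

theorem setIntegral_Ico_comp_equivFunL_symm [Fintype ι] {E : Type*} [NormedAddCommGroup E]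
    [NormedSpace ℝ E] (G : V → E) :
    ∫ c in Set.univ.pi fun _ : ι => Set.Ico (0 : ℝ) 1, G ((b.ofZLatticeBasis ℝ).equivFunL.symm c)
      = (ZLattice.covolume L μ)⁻¹ •
        ∫ v in ZSpan.fundamentalDomain (b.ofZLatticeBasis ℝ), G v ∂μ := by
  rw [← equivFunL_symm_preimage_fundamentalDomain (b.ofZLatticeBasis ℝ),
    (measurePreserving_equivFunL_symm b μ).setIntegral_preimage_emb
      (b.ofZLatticeBasis ℝ).equivFunL.symm.toHomeomorph.measurableEmbedding,
    Measure.restrict_smul, integral_smul_measure, ENNReal.toReal_inv,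
    ENNReal.toReal_ofReal (ZLattice.covolume_pos L μ).le]

theorem hasSum_fourierCoeff_of_latticePeriodic [Finite ι] {P : V → ℂ} (hP : Continuous P)
    (hper : ∀ v (γ : L), P (v + γ) = P v) {β : LinearMap.BilinForm ℝ V} (hβ : β.Nondegenerate)
    (hs : Summable fun η : β.dualSubmodule L =>
      ∫ v in ZSpan.fundamentalDomain (b.ofZLatticeBasis ℝ), 𝐞 (-β η v) • P v ∂μ) :
    HasSum (fun η : β.dualSubmodule L => (ZLattice.covolume L μ)⁻¹ •
      ∫ v in ZSpan.fundamentalDomain (b.ofZLatticeBasis ℝ), 𝐞 (-β η v) • P v ∂μ) (P 0) := by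
  cases nonempty_fintype ι
  obtain ⟨e, he⟩ := exists_equiv_dualSubmodule hβ b
  let A := (b.ofZLatticeBasis ℝ).equivFunL.symm
  have hcoeff : ∀ n : ι → ℤ,
      ∫ c in Set.univ.pi fun _ => Set.Ico (0 : ℝ) 1, 𝐞 (-∑ i, n i * c i) • P (A c)
      = (ZLattice.covolume L μ)⁻¹ • ∫ v in ZSpan.fundamentalDomain (b.ofZLatticeBasis ℝ),
          𝐞 (-β (e n) v) • P v ∂μ := fun n => by
    simp only [← setIntegral_Ico_comp_equivFunL_symm, he, repr_equivFunL_symm, A]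
  have hsum := hasSum_setIntegral_Ico_of_periodic (f := fun c => P (A c)) (hP.comp A.continuous)
    (fun x k => by simp only [map_add, A, equivFunL_symm_intCast b, hper])
    (by simpa only [hcoeff, Function.comp_def] using
      (e.summable_iff.2 hs).const_smul (ZLattice.covolume L μ)⁻¹)
  rw [← e.hasSum_iff]
  simpa only [hcoeff, map_zero, Function.comp_def] using hsum

end Coordinates

section Poisson

variable {V : Type*} [NormedAddCommGroup V] [NormedSpace ℝ V] {L : Submodule ℤ V}

theorem fourierChar_dualSubmodule_add {β : LinearMap.BilinForm ℝ V} (η : β.dualSubmodule L)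
    (v : V) (γ : L) : 𝐞 (-β η (v + γ)) = 𝐞 (-β η v) := by
  obtain ⟨n, hn⟩ := Submodule.mem_one.1 (η.2 γ γ.2)
  have hshift : -β η (v + γ) = -β η v + ((-n : ℤ) : ℝ) := by
    rw [map_add, ← hn]
    simp [add_comm]
  rw [hshift, Real.fourierChar_apply', Real.fourierChar_apply', mul_add, mul_comm _ ((-n : ℤ) : ℝ),
    Circle.periodic_exp.int_mul]

variable [FiniteDimensional ℝ V] [MeasurableSpace V] [BorelSpace V] [DiscreteTopology L]
  [IsZLattice ℝ L]

theorem LocallySummable.hasSum_poisson {F : V → ℂ} (h : LocallySummable L F) (hF : Continuous F)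
    {β : LinearMap.BilinForm ℝ V} (hβ : β.Nondegenerate) (μ : Measure V) [μ.IsAddHaarMeasure]
    (hs : Summable fun η : β.dualSubmodule L => ∫ v, 𝐞 (-β η v) • F v ∂μ) :
    HasSum (fun η : β.dualSubmodule L =>
      (ZLattice.covolume L μ)⁻¹ • ∫ v, 𝐞 (-β η v) • F v ∂μ) (∑' γ : L, F γ) := by
  have : Module.Finite ℤ L := ZLattice.module_finite ℝ L
  have : Module.Free ℤ L := ZLattice.module_free ℝ L
  let b := Free.chooseBasis ℤ L
  let P : V → ℂ := fun v => ∑' γ : L, F (v + γ)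
  have hP_periodic : ∀ v (γ : L), P (v + γ) = P v := fun v γ => by
    simp only [P, add_assoc]
    exact (Equiv.addLeft γ).tsum_eq fun γ' : L => F (v + γ')
  have hunfold : ∀ η : β.dualSubmodule L, ∫ v, 𝐞 (-β η v) • F v ∂μ
      = ∫ v in ZSpan.fundamentalDomain (b.ofZLatticeBasis ℝ), 𝐞 (-β η v) • P v ∂μ := fun η => by
    have hmod : LocallySummable L fun v => 𝐞 (-β η v) • F v :=
      h.congr_norm fun v => Circle.norm_smul _ _
    have hβη : Continuous (β η) := (β η).continuous_of_finiteDimensional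
    rw [← hmod.setIntegral_tsum μ (by fun_prop) b]
    simp only [fourierChar_dualSubmodule_add, Circle.smul_def, smul_eq_mul, tsum_mul_left, P]
  simp only [hunfold] at hs ⊢
  simpa only [P, zero_add] using
    hasSum_fourierCoeff_of_latticePeriodic b μ (h.continuous_tsum hF) hP_periodic hβ hs

end Poisson

/-! ### Sums over lattices -/

theorem inv_pow_le_pow_mul_inv_pow {a b A : ℝ} (ha : 0 < a) (hb : 0 < b) (h : b ≤ A * a)
    (n : ℕ) : (a ^ n)⁻¹ ≤ A ^ n * (b ^ n)⁻¹ := by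
  rw [← div_eq_mul_inv, le_div_iff₀ (by positivity), inv_mul_le_iff₀ (by positivity), ← mul_pow,
    mul_comm a]
  gcongr

section LatticeSums

variable {V : Type*} [NormedAddCommGroup V]

theorem one_add_norm_add_le_mul (v w : V) : 1 + ‖v + w‖ ≤ (1 + ‖v‖) * (1 + ‖w‖) := by
  nlinarith [norm_add_le v w, mul_nonneg (norm_nonneg v) (norm_nonneg w)]

variable [NormedSpace ℝ V] [FiniteDimensional ℝ V]

theorem exists_norm_sub_le (L : Submodule ℤ V) [DiscreteTopology L] [IsZLattice ℝ L] :
    ∃ R : ℝ, 0 ≤ R ∧ ∀ v : V, ∃ γ : L, ‖v - γ‖ ≤ R := by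
  have : Module.Finite ℤ L := ZLattice.module_finite ℝ L
  have : Module.Free ℤ L := ZLattice.module_free ℝ L
  let b := Free.chooseBasis ℤ L
  let B := b.ofZLatticeBasis ℝ
  obtain ⟨R, hR⟩ := (ZSpan.fundamentalDomain_isBounded B).exists_norm_le
  refine ⟨R, (norm_nonneg _).trans (hR _ (ZSpan.fract_mem_fundamentalDomain B 0)), fun v => ?_⟩
  exact ⟨⟨ZSpan.floor B v, (b.ofZLatticeBasis_span ℝ).le (ZSpan.floor B v).2⟩,
    hR _ (ZSpan.fract_mem_fundamentalDomain B v)⟩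

theorem summable_one_add_norm_pow_inv (L : Submodule ℤ V) [DiscreteTopology L] {n : ℕ}
    (hn : finrank ℤ L < n) : Summable fun γ : L => ((1 + ‖(γ : V)‖) ^ n)⁻¹ := by
  refine .of_norm_bounded_eventually (ZLattice.summable_norm_pow_inv L n hn) ?_
  filter_upwards [(Set.finite_singleton (0 : L)).compl_mem_cofinite] with γ hγ
  have hγ' : 0 < ‖γ‖ := norm_pos_iff.2 hγ
  rw [Real.norm_of_nonneg (by positivity), inv_pow]
  gcongr
  simp

theorem exists_sum_translate_le (L : Submodule ℤ V) [DiscreteTopology L] [IsZLattice ℝ L]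
    {n : ℕ} (hn : finrank ℝ V < n) :
    ∃ C : ℝ, ∀ (v : V) (s : Finset L), ∑ γ ∈ s, ((1 + ‖v + γ‖) ^ n)⁻¹ ≤ C := by
  obtain ⟨R, hR0, hR⟩ := exists_norm_sub_le L
  have hsum := summable_one_add_norm_pow_inv L ((ZLattice.rank ℝ L).trans_lt hn)
  refine ⟨(1 + R) ^ n * ∑' γ : L, ((1 + ‖(γ : V)‖) ^ n)⁻¹, fun v s => ?_⟩
  obtain ⟨γ₀, hγ₀⟩ := hR v
  have hshift (γ : L) : 1 + ‖((γ₀ + γ : L) : V)‖ ≤ (1 + R) * (1 + ‖v + γ‖) := by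
    calc 1 + ‖((γ₀ + γ : L) : V)‖ = 1 + ‖-(v - γ₀) + (v + γ)‖ := by
          rw [Submodule.coe_add]
          congr 2
          abel
      _ ≤ (1 + ‖-(v - γ₀)‖) * (1 + ‖v + γ‖) := one_add_norm_add_le_mul _ _
      _ ≤ (1 + R) * (1 + ‖v + γ‖) := by
          rw [norm_neg]
          gcongr
  calc ∑ γ ∈ s, ((1 + ‖v + γ‖) ^ n)⁻¹
      ≤ ∑ γ ∈ s, (1 + R) ^ n * ((1 + ‖((γ₀ + γ : L) : V)‖) ^ n)⁻¹ :=
        Finset.sum_le_sum fun γ _ =>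
          inv_pow_le_pow_mul_inv_pow (by positivity) (by positivity) (hshift γ) n
    _ = (1 + R) ^ n * ∑ γ ∈ s.map (addLeftEmbedding γ₀), ((1 + ‖(γ : V)‖) ^ n)⁻¹ := by
        rw [Finset.sum_map, Finset.mul_sum]
        rfl
    _ ≤ (1 + R) ^ n * ∑' γ : L, ((1 + ‖(γ : V)‖) ^ n)⁻¹ := by
        gcongr
        exact hsum.sum_le_tsum _ fun _ _ => by positivity

end LatticeSums

/-! ### The Fourier transform on `L¹ ∩ L²` -/

section Plancherel

variable {V : Type*} [NormedAddCommGroup V] [InnerProductSpace ℝ V] [FiniteDimensional ℝ V]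
  [MeasurableSpace V] [BorelSpace V]

theorem continuous_fourier {f : V → ℂ} (hf : Integrable f) : Continuous (𝓕 f) :=
  VectorFourier.fourierIntegral_continuous Real.continuous_fourierChar
    (innerSL ℝ).continuous₂ hf

theorem integral_fourier_mul_eq {f g : V → ℂ} (hf : Integrable f) (hg : Integrable g) :
    ∫ ξ, 𝓕 f ξ * g ξ = ∫ x, f x * 𝓕 g x := by
  have h := VectorFourier.integral_fourierIntegral_smul_eq_flip (L := innerₗ V)
    Real.continuous_fourierChar (innerSL ℝ).continuous₂ hf hg
  rw [flip_innerₗ] at h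
  exact h

theorem fourier_comp_add_right (f : V → ℂ) (v w : V) :
    𝓕 (fun x => f (x + v)) w = 𝐞 (inner ℝ v w) • 𝓕 f w :=
  congrFun (VectorFourier.fourierIntegral_comp_add_right 𝐞 volume (innerₗ V) f v) w

theorem fourierInv_comp_sub_right (f : V → ℂ) (v w : V) :
    𝓕⁻ (fun x => f (x - v)) w = 𝐞 (inner ℝ v w) • 𝓕⁻ f w := by
  simp only [Real.fourierInv_eq_fourier_neg, sub_eq_add_neg, fourier_comp_add_right,
    inner_neg_left, inner_neg_right, neg_neg]

theorem fourier_toLp_ae_eq {f : V → ℂ} (hf : Integrable f) (hf₂ : MemLp f 2) :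
    ((𝓕 hf₂.toLp : Lp ℂ 2 (volume : Measure V)) : V → ℂ) =ᵐ[volume] 𝓕 f := by
  refine ae_eq_of_integral_contDiff_smul_eq ((Lp.memLp (𝓕 hf₂.toLp)).locallyIntegrable (by simp))
    (continuous_fourier hf).locallyIntegrable fun φ hφ hφc => ?_
  have hφc' : HasCompactSupport (Complex.ofRealCLM ∘ φ) := hφc.comp_left rfl
  let θ : SchwartzMap V ℂ := hφc'.toSchwartzMap (by fun_prop)
  have hweak : ∫ x, θ x * (𝓕 hf₂.toLp : Lp ℂ 2 (volume : Measure V)) x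
      = ∫ x, (𝓕 θ) x * (hf₂.toLp : V → ℂ) x := by
    simpa only [TemperedDistribution.fourier_apply, Lp.toTemperedDistribution_apply, smul_eq_mul]
      using congrArg (fun T => T θ) (Lp.fourier_toTemperedDistribution_eq hf₂.toLp).symm
  have hrepr : ∫ x, (𝓕 θ) x * (hf₂.toLp : V → ℂ) x = ∫ x, 𝓕 (θ : V → ℂ) x * f x := by
    refine integral_congr_ae ?_
    filter_upwards [hf₂.coeFn_toLp] with x hx
    rw [hx, SchwartzMap.fourier_coe]
  rw [integral_fourier_mul_eq θ.integrable hf] at hrepr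
  exact hweak.trans hrepr

theorem memLp_fourier {f : V → ℂ} (hf : Integrable f) (hf₂ : MemLp f 2) : MemLp (𝓕 f) 2 :=
  (memLp_congr_ae (fourier_toLp_ae_eq hf hf₂)).1 (Lp.memLp _)

theorem integral_mul_conj_fourier_Lp (F : Lp ℂ 2 (volume : Measure V)) {g : V → ℂ}
    (hg : Integrable g) (hg₂ : MemLp g 2) :
    ∫ t, (𝓕 F : Lp ℂ 2 (volume : Measure V)) t * conj (𝓕 g t) = ∫ t, F t * conj (g t) := by
  have h := Lp.inner_fourier_eq hg₂.toLp F
  simp only [L2.inner_def, RCLike.inner_apply] at h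
  have hleft : ∫ t, (𝓕 F : Lp ℂ 2 (volume : Measure V)) t * conj (𝓕 g t)
      = ∫ t, (𝓕 F : Lp ℂ 2 (volume : Measure V)) t
        * conj ((𝓕 hg₂.toLp : Lp ℂ 2 (volume : Measure V)) t) := by
    refine integral_congr_ae ?_
    filter_upwards [fourier_toLp_ae_eq hg hg₂] with t ht
    rw [ht]
  rw [hleft, h]
  refine integral_congr_ae ?_
  filter_upwards [hg₂.coeFn_toLp] with t ht
  rw [ht]

theorem integral_mul_conj_fourier {f g : V → ℂ} (hf : Integrable f) (hf₂ : MemLp f 2)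
    (hg : Integrable g) (hg₂ : MemLp g 2) :
    ∫ t, 𝓕 f t * conj (𝓕 g t) = ∫ t, f t * conj (g t) := by
  trans ∫ t, (𝓕 hf₂.toLp : Lp ℂ 2 (volume : Measure V)) t * conj (𝓕 g t)
  · refine integral_congr_ae ?_
    filter_upwards [fourier_toLp_ae_eq hf hf₂] with t ht
    rw [ht]
  · rw [integral_mul_conj_fourier_Lp _ hg hg₂]
    refine integral_congr_ae ?_
    filter_upwards [hf₂.coeFn_toLp] with t ht
    rw [ht]

theorem integral_norm_sq_fourier {f : V → ℂ} (hf : Integrable f) (hf₂ : MemLp f 2) :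
    ∫ t, ‖𝓕 f t‖ ^ 2 = ∫ t, ‖f t‖ ^ 2 := by
  have h := integral_mul_conj_fourier hf hf₂ hf hf₂
  simp only [RCLike.mul_conj, ← RCLike.ofReal_pow, integral_ofReal] at h
  exact_mod_cast h

theorem fourier_mul_conj_fourierInv {u v : V → ℂ} (hu : Integrable u) (hu₂ : MemLp u 2)
    (hv : Integrable v) (hv₂ : MemLp v 2) (ω : V) :
    𝓕 (fun y => 𝓕⁻ u y * conj (𝓕⁻ v y)) ω = ∫ t, u t * conj (v (t - ω)) := by
  rw [← integral_mul_conj_fourier hu hu₂ (hv.comp_sub_right ω)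
      (hv₂.comp_measurePreserving (measurePreserving_sub_right volume ω)), Real.fourier_eq,
    ← integral_neg_eq_self (fun t => 𝓕 u t * conj (𝓕 (fun t => v (t - ω)) t))]
  congr with y
  simp only [← Real.fourierInv_eq_fourier_neg, fourierInv_comp_sub_right, Circle.smul_def,
    smul_eq_mul, map_mul]
  rw [← Circle.coe_inv_eq_conj, ← AddChar.map_neg_eq_inv, real_inner_comm]
  ring

end Plancherel

/-! ### Plancherel–Pólya inequalities -/

theorem sq_integral_mul_le_mul_integral {α : Type*} [MeasurableSpace α] {μ : Measure α}
    {a w : α → ℝ} (ha : AEStronglyMeasurable a μ) (hw : Integrable w μ) (hw₀ : ∀ x, 0 ≤ w x)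
    (haw : Integrable (fun x => a x ^ 2 * w x) μ) :
    Integrable (fun x => a x * w x) μ ∧
      (∫ x, a x * w x ∂μ) ^ 2 ≤ (∫ x, a x ^ 2 * w x ∂μ) * ∫ x, w x ∂μ := by
  have hint : Integrable (fun x => a x * w x) μ := by
    refine (haw.add hw).mono' (ha.mul hw.1) (.of_forall fun x => ?_)
    rw [norm_mul, Real.norm_of_nonneg (hw₀ x), Real.norm_eq_abs, Pi.add_apply]
    nlinarith [hw₀ x, mul_nonneg (hw₀ x) (sq_nonneg (|a x| - 1)), sq_abs (a x),
      mul_nonneg (hw₀ x) (abs_nonneg (a x))]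
  refine ⟨hint, ?_⟩
  have hquad (t : ℝ) : 0 ≤ (∫ x, w x ∂μ) * (t * t) + (-2 * ∫ x, a x * w x ∂μ) * t
      + ∫ x, a x ^ 2 * w x ∂μ := by
    have hexpand : ∫ x, (a x - t) ^ 2 * w x ∂μ = (∫ x, w x ∂μ) * (t * t)
        + (-2 * ∫ x, a x * w x ∂μ) * t + ∫ x, a x ^ 2 * w x ∂μ := by
      rw [mul_right_comm, ← integral_mul_const, ← integral_const_mul, ← integral_add,
        ← integral_add]
      · congr with x
        ring
      all_goals fun_prop
    rw [← hexpand]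
    exact integral_nonneg fun x => mul_nonneg (sq_nonneg _) (hw₀ x)
  have := discrim_le_zero hquad
  rw [discrim] at this
  linarith

theorem exists_schwartzMap_norm_le {V : Type*} [NormedAddCommGroup V] [NormedSpace ℝ V]
    (θ : SchwartzMap V ℂ) (n : ℕ) :
    ∃ C : ℝ, ∀ w, ‖θ w‖ ≤ C * ((1 + ‖w‖) ^ n)⁻¹ := by
  refine ⟨2 ^ n * ((Finset.Iic (n, 0)).sup fun m => SchwartzMap.seminorm ℝ m.1 m.2) θ,
    fun w => ?_⟩
  rw [← div_eq_mul_inv, le_div_iff₀ (by positivity), mul_comm]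
  simpa only [norm_iteratedFDeriv_zero] using
    SchwartzMap.one_add_le_sup_seminorm_apply (𝕜 := ℝ) (m := (n, 0)) le_rfl le_rfl θ w

theorem one_add_norm_mk_zero_add_le {V W : Type*} [NormedAddCommGroup V] [NormedAddCommGroup W]
    {R S : ℝ} {v γ : V × W} (hv : ‖v‖ ≤ R) (hS : ‖(v + γ).2‖ ≤ S) (z : V) :
    1 + ‖(z, 0) + γ‖ ≤ (1 + R + S) * (1 + ‖z + (v + γ).1‖) := by
  have hR₀ : 0 ≤ R := (norm_nonneg v).trans hv
  have hS₀ : 0 ≤ S := (norm_nonneg _).trans hS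
  have hsub : (z, 0) + γ = (z + (v + γ).1, (v + γ).2) - v := by
    ext
    · simp only [Prod.fst_add, Prod.fst_sub]
      abel
    · simp
  have hnorm : ‖(z, 0) + γ‖ ≤ ‖z + (v + γ).1‖ + S + R := by
    rw [hsub]
    refine (norm_sub_le _ _).trans (add_le_add (max_le ?_ ?_) hv)
    · exact le_add_of_nonneg_right hS₀
    · exact hS.trans (le_add_of_nonneg_left (norm_nonneg _))
  nlinarith [norm_nonneg (z + (v + γ).1)]

section Sampling

variable {V : Type*} [NormedAddCommGroup V] [MeasurableSpace V] [BorelSpace V]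

theorem integrable_mul_one_add_norm_pow_inv {E : Type*} [NormedAddCommGroup E] {μ : Measure V}
    {a : V → ℝ} (ha : Integrable a μ) {T : V → E} (hT : Continuous T) (n : ℕ) :
    Integrable (fun z => a z * ((1 + ‖T z‖) ^ n)⁻¹) μ := by
  refine ha.mul_bdd (c := 1) ?_ (.of_forall fun z => ?_)
  · exact (Continuous.inv₀ (by fun_prop) fun z => by positivity).aestronglyMeasurable
  · rw [Real.norm_of_nonneg (by positivity)]
    exact inv_le_one_of_one_le₀ (one_le_pow₀ (by linarith [norm_nonneg (T z)]))

theorem exists_tsum_integral_translate_le {E : Type*} [NormedAddCommGroup E] [NormedSpace ℝ E]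
    [FiniteDimensional ℝ E] (L : Submodule ℤ E) [DiscreteTopology L] [IsZLattice ℝ L] {n : ℕ}
    (hn : finrank ℝ E < n) (μ : Measure V) {T : V → E} (hT : Continuous T) :
    ∃ C : ℝ, ∀ a : V → ℝ, Integrable a μ → (∀ z, 0 ≤ a z) →
      Summable (fun γ : L => ∫ z, a z * ((1 + ‖T z + γ‖) ^ n)⁻¹ ∂μ) ∧
        ∑' γ : L, ∫ z, a z * ((1 + ‖T z + γ‖) ^ n)⁻¹ ∂μ ≤ C * ∫ z, a z ∂μ := by
  obtain ⟨C, hC⟩ := exists_sum_translate_le L hn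
  refine ⟨C, fun a ha ha₀ => ?_⟩
  have hint (γ : L) : Integrable (fun z => a z * ((1 + ‖T z + γ‖) ^ n)⁻¹) μ :=
    integrable_mul_one_add_norm_pow_inv ha (by fun_prop) n
  have hsum (s : Finset L) :
      ∑ γ ∈ s, ∫ z, a z * ((1 + ‖T z + γ‖) ^ n)⁻¹ ∂μ ≤ C * ∫ z, a z ∂μ := by
    rw [← integral_finsetSum _ fun γ _ => hint γ, ← integral_const_mul]
    refine integral_mono (integrable_finsetSum _ fun γ _ => hint γ) (ha.const_mul C) fun z => ?_
    simp only [← Finset.mul_sum, mul_comm C]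
    exact mul_le_mul_of_nonneg_left (hC (T z) s) (ha₀ z)
  have hnonneg (γ : L) : 0 ≤ ∫ z, a z * ((1 + ‖T z + γ‖) ^ n)⁻¹ ∂μ :=
    integral_nonneg fun z => mul_nonneg (ha₀ z) (by positivity)
  have hs := summable_of_sum_le hnonneg hsum
  exact ⟨hs, hs.tsum_le_of_sum_le hsum⟩

variable [InnerProductSpace ℝ V] [FiniteDimensional ℝ V]

theorem integrable_one_add_norm_pow_inv {n : ℕ} (hn : finrank ℝ V < n) :
    Integrable fun z : V => ((1 + ‖z‖) ^ n)⁻¹ := by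
  simpa only [Real.rpow_neg (add_nonneg zero_le_one (norm_nonneg _)), Real.rpow_natCast] using
    integrable_one_add_norm (E := V) (μ := volume) (r := n) (by exact_mod_cast hn)

theorem exists_schwartz_fourier_eq_one {K : Set V} (hK : IsCompact K) :
    ∃ θ : SchwartzMap V ℂ, ∀ t ∈ K, 𝓕 (θ : V → ℂ) t = 1 := by
  obtain ⟨r, hr₀, hr⟩ := hK.isBounded.subset_closedBall_lt 0 0
  let χ : ContDiffBump (0 : V) := ⟨r, r + 1, hr₀, by linarith⟩
  have hχ : HasCompactSupport (Complex.ofRealCLM ∘ χ) := χ.hasCompactSupport.comp_left rfl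
  refine ⟨𝓕⁻ (hχ.toSchwartzMap (Complex.ofRealCLM.contDiff.comp χ.contDiff)), fun t ht => ?_⟩
  rw [← SchwartzMap.fourier_coe, FourierTransform.fourier_fourierInv_eq]
  exact congrArg Complex.ofReal (χ.one_of_mem_closedBall (hr ht))

theorem fourierInv_eq_integral_fourier_mul {K : Set V} {u : V → ℂ} (hu : Integrable u)
    (huK : ∀ᵐ t, t ∉ K → u t = 0) {θ : SchwartzMap V ℂ} (hθ : ∀ t ∈ K, 𝓕 (θ : V → ℂ) t = 1)
    (y : V) : 𝓕⁻ u y = ∫ z, 𝓕 u z * θ (z + y) := by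
  rw [integral_fourier_mul_eq hu (θ.integrable.comp_add_right y), Real.fourierInv_eq]
  refine integral_congr_ae ?_
  filter_upwards [huK] with t ht
  rw [fourier_comp_add_right (θ : V → ℂ), real_inner_comm]
  by_cases htK : t ∈ K
  · simp [hθ t htK, Circle.smul_def, mul_comm]
  · simp [ht htK]

theorem exists_norm_sq_fourierInv_le {K : Set V} (hK : IsCompact K) {n : ℕ}
    (hn : finrank ℝ V < n) :
    ∃ C : ℝ, 0 ≤ C ∧ ∀ u : V → ℂ, Integrable u → MemLp u 2 → (∀ᵐ t, t ∉ K → u t = 0) →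
      ∀ y, ‖𝓕⁻ u y‖ ^ 2 ≤ C * ∫ z, ‖𝓕 u z‖ ^ 2 * ((1 + ‖z + y‖) ^ n)⁻¹ := by
  obtain ⟨θ, hθ⟩ := exists_schwartz_fourier_eq_one hK
  obtain ⟨C, hC⟩ := exists_schwartzMap_norm_le θ n
  have hweight := integrable_one_add_norm_pow_inv hn
  refine ⟨C ^ 2 * ∫ z : V, ((1 + ‖z‖) ^ n)⁻¹,
    mul_nonneg (by positivity) (integral_nonneg fun z => by positivity),
    fun u hu hu₂ huK y => ?_⟩
  obtain ⟨hint, hCS⟩ := sq_integral_mul_le_mul_integral (memLp_fourier hu hu₂).1.norm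
    (hweight.comp_add_right y) (fun z => by positivity)
    (integrable_mul_one_add_norm_pow_inv ((memLp_fourier hu hu₂).integrable_norm_pow two_ne_zero)
      (T := fun z => z + y) (by fun_prop) n)
  rw [integral_add_right_eq_self (fun z : V => ((1 + ‖z‖) ^ n)⁻¹) y] at hCS
  have hpointwise : ‖𝓕⁻ u y‖ ≤ C * ∫ z, ‖𝓕 u z‖ * ((1 + ‖z + y‖) ^ n)⁻¹ := by
    rw [fourierInv_eq_integral_fourier_mul hu huK hθ, ← integral_const_mul]
    refine norm_integral_le_of_norm_le (hint.const_mul C) (.of_forall fun z => ?_)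
    rw [norm_mul, mul_left_comm]
    gcongr
    exact hC _
  calc ‖𝓕⁻ u y‖ ^ 2 ≤ (C * ∫ z, ‖𝓕 u z‖ * ((1 + ‖z + y‖) ^ n)⁻¹) ^ 2 := by gcongr
    _ = C ^ 2 * (∫ z, ‖𝓕 u z‖ * ((1 + ‖z + y‖) ^ n)⁻¹) ^ 2 := mul_pow _ _ 2
    _ ≤ C ^ 2 * ((∫ z, ‖𝓕 u z‖ ^ 2 * ((1 + ‖z + y‖) ^ n)⁻¹)
        * ∫ z : V, ((1 + ‖z‖) ^ n)⁻¹) := by gcongr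
    _ = _ := by ring

-- The constant is uniform in `u`, and one sequence `c` serves all `v` in a ball: this is what
-- allows summation over families and the Poisson summation formula, respectively.
theorem exists_sampling_bound {W : Type*} [NormedAddCommGroup W] [NormedSpace ℝ W]
    [FiniteDimensional ℝ W] (Γ : Submodule ℤ (V × W)) [DiscreteTopology Γ] [IsZLattice ℝ Γ]
    {K : Set V} (hK : IsCompact K) {R S : ℝ} (hR : 0 ≤ R) (hS : 0 ≤ S) :
    ∃ M : ℝ, ∀ u : V → ℂ, Integrable u → MemLp u 2 → (∀ᵐ t, t ∉ K → u t = 0) →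
      ∃ c : Γ → ℝ, (∀ γ, 0 ≤ c γ) ∧ Summable c ∧ ∑' γ, c γ ≤ M * ∫ t, ‖u t‖ ^ 2 ∧
        ∀ (γ : Γ) (v : V × W), ‖v‖ ≤ R → ‖(v + γ).2‖ ≤ S → ‖𝓕⁻ u (v + γ).1‖ ^ 2 ≤ c γ := by
  obtain ⟨n, hn⟩ := exists_gt (finrank ℝ (V × W))
  have hn' : finrank ℝ V < n := (finrank_prod (R := ℝ) (M := V) (M' := W) ▸ hn).trans_le' (by simp)
  obtain ⟨C, hC₀, hC⟩ := exists_norm_sq_fourierInv_le hK hn'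
  obtain ⟨D, hD⟩ := exists_tsum_integral_translate_le Γ hn volume
    (T := fun z : V => ((z, 0) : V × W)) (by fun_prop)
  refine ⟨C * (1 + R + S) ^ n * D, fun u hu hu₂ huK => ?_⟩
  have hfu := (memLp_fourier hu hu₂).integrable_norm_pow two_ne_zero
  obtain ⟨hsum, hle⟩ := hD _ hfu fun z => by positivity
  have hsum' := hsum.mul_left (C * (1 + R + S) ^ n)
  refine ⟨_, fun γ => ?_, hsum', ?_, fun γ v hv hvS => (hC u hu hu₂ huK _).trans ?_⟩
  · exact mul_nonneg (by positivity) (integral_nonneg fun z => by positivity)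
  · rw [tsum_mul_left, mul_assoc _ D, ← integral_norm_sq_fourier hu hu₂]
    exact mul_le_mul_of_nonneg_left hle (by positivity)
  · refine (mul_le_mul_of_nonneg_left ?_ hC₀).trans_eq (mul_assoc _ _ _).symm
    rw [← integral_const_mul]
    refine integral_mono
      (integrable_mul_one_add_norm_pow_inv hfu (T := fun z => z + (v + γ).1) (by fun_prop) n)
      ((integrable_mul_one_add_norm_pow_inv hfu (by fun_prop) n).const_mul _) fun z => ?_
    dsimp only
    rw [mul_left_comm]
    gcongr
    exact inv_pow_le_pow_mul_inv_pow (by positivity) (by positivity)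
      (one_add_norm_mk_zero_add_le hv hvS z) n

end Sampling

/-! ### Cubes and amalgam spaces -/

section Wiener

variable {m : ℕ}

theorem box_eq_preimage (x : EuclideanSpace ℝ (Fin m)) (R : ℝ) :
    box x R = (MeasurableEquiv.toLp 2 (Fin m → ℝ)).symm ⁻¹'
      (Set.univ.pi fun i => Set.Icc (x i) (x i + R)) := by
  ext y
  simp only [box, Set.mem_ofPred_eq, Set.mem_preimage, Set.mem_pi, Set.mem_univ, forall_const,
    Set.mem_Icc]
  rfl

theorem measurableSet_box (x : EuclideanSpace ℝ (Fin m)) (R : ℝ) : MeasurableSet (box x R) := by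
  rw [box_eq_preimage]
  exact MeasurableEquiv.measurable _ (.univ_pi fun i => measurableSet_Icc)

theorem volume_box (x : EuclideanSpace ℝ (Fin m)) (R : ℝ) :
    volume (box x R) = ENNReal.ofReal R ^ m := by
  rw [box_eq_preimage,
    (EuclideanSpace.volume_preserving_symm_measurableEquiv_toLp (Fin m)).measure_preimage
      (MeasurableSet.univ_pi fun i => measurableSet_Icc).nullMeasurableSet, volume_pi_pi]
  simp

theorem volume_box_lt_top (x : EuclideanSpace ℝ (Fin m)) (R : ℝ) : volume (box x R) < ∞ := by
  rw [volume_box]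
  exact ENNReal.pow_lt_top ENNReal.ofReal_lt_top

theorem iUnion_box_eq_univ :
    ⋃ k : Fin m → ℤ, box (WithLp.toLp 2 fun i => (k i : ℝ)) 1 = Set.univ :=
  Set.eq_univ_of_forall fun y => Set.mem_iUnion.2
    ⟨fun i => ⌊y i⌋, fun _ => ⟨Int.floor_le _, (Int.lt_floor_add_one _).le⟩⟩

theorem lintegral_le_tsum_box (F : EuclideanSpace ℝ (Fin m) → ℝ≥0∞) :
    ∫⁻ t, F t ≤ ∑' k : Fin m → ℤ, ∫⁻ t in box (WithLp.toLp 2 fun i => (k i : ℝ)) 1, F t := by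
  rw [← setLIntegral_univ, ← iUnion_box_eq_univ]
  exact lintegral_iUnion_le _ _

theorem wienerNorm_eq_tsum_restrict (p : ℝ≥0∞) (F : EuclideanSpace ℝ (Fin m) → ℂ) :
    wienerNorm p F = ∑' k : Fin m → ℤ,
      eLpNorm F p (volume.restrict (box (WithLp.toLp 2 fun i => (k i : ℝ)) 1)) := by
  simp only [wienerNorm, eLpNorm_indicator_eq_eLpNorm_restrict (measurableSet_box _ _)]

theorem MemWiener.integrable {p : ℝ≥0∞} (hp : 1 ≤ p) {g : EuclideanSpace ℝ (Fin m) → ℂ}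
    (hg : MemWiener p g) : Integrable g := by
  refine ⟨hg.1, (lintegral_le_tsum_box _).trans_lt (lt_of_le_of_lt ?_ hg.2)⟩
  rw [wienerNorm_eq_tsum_restrict]
  refine ENNReal.tsum_le_tsum fun k => ?_
  rw [← eLpNorm_one_eq_lintegral_enorm]
  refine (eLpNorm_le_eLpNorm_mul_rpow_measure_univ hp hg.1.restrict).trans_eq ?_
  simp [volume_box]

theorem tsum_rpow_le_rpow_tsum {ι : Type*} (a : ι → ℝ≥0∞) {p : ℝ} (hp : 1 ≤ p) :
    ∑' i, a i ^ p ≤ (∑' i, a i) ^ p := by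
  have hsplit (x : ℝ≥0∞) : x ^ p = x * x ^ (p - 1) := by
    conv_lhs => rw [← add_sub_cancel 1 p]
    rw [ENNReal.rpow_add_of_nonneg _ _ zero_le_one (by linarith), ENNReal.rpow_one]
  rw [hsplit, ← ENNReal.tsum_mul_right]
  refine ENNReal.tsum_le_tsum fun i => ?_
  rw [hsplit]
  gcongr
  exact ENNReal.le_tsum i

theorem MemWiener.memLp {p : ℝ≥0∞} (hp : 1 ≤ p) (hp' : p ≠ ∞)
    {g : EuclideanSpace ℝ (Fin m) → ℂ} (hg : MemWiener p g) : MemLp g p := by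
  have hp₀ : p ≠ 0 := (one_pos.trans_le hp).ne'
  have hpos : 0 < p.toReal := ENNReal.toReal_pos hp₀ hp'
  refine ⟨hg.1, (eLpNorm_lt_top_iff_lintegral_rpow_enorm_lt_top hp₀ hp').2 ?_⟩
  refine (lintegral_le_tsum_box _).trans_lt (lt_of_le_of_lt ?_
    (ENNReal.rpow_lt_top_of_nonneg hpos.le hg.2.ne))
  rw [wienerNorm_eq_tsum_restrict]
  refine le_trans (le_of_eq ?_) (tsum_rpow_le_rpow_tsum _ (ENNReal.toReal_mono hp' hp))
  simp_rw [eLpNorm_eq_lintegral_rpow_enorm_toReal hp₀ hp', one_div,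
    ENNReal.rpow_inv_rpow hpos.ne']

end Wiener

/-! ### Mean values of trigonometric series -/

section Means

variable {m : ℕ}

theorem character_eq_fourierChar (ω t : EuclideanSpace ℝ (Fin m)) :
    character ω t = 𝐞 (inner ℝ ω t) := by
  rw [character, Real.fourierChar_apply]
  push_cast
  ring_nf

theorem norm_character (ω t : EuclideanSpace ℝ (Fin m)) : ‖character ω t‖ = 1 := by
  rw [character_eq_fourierChar, Circle.norm_coe]

theorem continuous_character (ω : EuclideanSpace ℝ (Fin m)) : Continuous (character ω) := by
  unfold character
  fun_prop

theorem character_add_left (ω ω' t : EuclideanSpace ℝ (Fin m)) :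
    character (ω + ω') t = character ω t * character ω' t := by
  simp only [character_eq_fourierChar, inner_add_left, AddChar.map_add_eq_mul, Circle.coe_mul]

theorem character_add_right (ω t t' : EuclideanSpace ℝ (Fin m)) :
    character ω (t + t') = character ω t * character ω t' := by
  simp only [character_eq_fourierChar, inner_add_right, AddChar.map_add_eq_mul, Circle.coe_mul]

theorem character_eq_prod (ω t : EuclideanSpace ℝ (Fin m)) :
    character ω t = ∏ i, (𝐞 (ω i * t i) : ℂ) := by
  simp only [character_eq_fourierChar, PiLp.inner_apply, RCLike.inner_apply, conj_trivial,
    Real.fourierChar_apply, ← Complex.exp_sum, ← Complex.ofReal_sum,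
    ← Finset.mul_sum, mul_comm]

theorem norm_setIntegral_Icc_fourierChar_le {w : ℝ} (hw : w ≠ 0) {a b : ℝ} (hab : a ≤ b) :
    ‖∫ s in Set.Icc a b, (𝐞 (w * s) : ℂ)‖ ≤ (Real.pi * |w|)⁻¹ := by
  set c : ℂ := (2 * Real.pi * w : ℝ) * Complex.I
  have hc : c ≠ 0 := by simp [c, hw, Real.pi_ne_zero]
  have hexp (s : ℝ) : (𝐞 (w * s) : ℂ) = Complex.exp (c * s) := by
    rw [Real.fourierChar_apply]
    simp only [c]
    push_cast
    ring_nf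
  have hnorm : ‖c‖ = 2 * (Real.pi * |w|) := by
    simp only [c, norm_mul, Complex.norm_I, Complex.norm_real, Real.norm_eq_abs,
      abs_two, abs_of_pos Real.pi_pos]
    ring
  simp only [hexp]
  rw [integral_Icc_eq_integral_Ioc, ← intervalIntegral.integral_of_le hab,
    integral_exp_mul_complex hc, norm_div, hnorm, ← hexp, ← hexp, div_le_iff₀ (by positivity)]
  calc ‖(𝐞 (w * b) : ℂ) - 𝐞 (w * a)‖ ≤ ‖(𝐞 (w * b) : ℂ)‖ + ‖(𝐞 (w * a) : ℂ)‖ := norm_sub_le _ _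
    _ = (Real.pi * |w|)⁻¹ * (2 * (Real.pi * |w|)) := by
        rw [Circle.norm_coe, Circle.norm_coe]
        field_simp
        norm_num

theorem tendsto_mean_fourierChar (w a : ℝ) :
    Tendsto (fun R : ℝ => (R : ℂ)⁻¹ * ∫ s in Set.Icc a (a + R), (𝐞 (w * s) : ℂ)) atTop
      (𝓝 (if w = 0 then 1 else 0)) := by
  split_ifs with hw
  · refine tendsto_const_nhds.congr' ?_
    filter_upwards [eventually_gt_atTop 0] with R hR
    have : (R : ℂ) ≠ 0 := by exact_mod_cast hR.ne'
    simp [hw, Measure.real, ENNReal.toReal_ofReal hR.le, this]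
  · rw [tendsto_zero_iff_norm_tendsto_zero]
    refine squeeze_zero' (g := fun R : ℝ => R⁻¹ * (Real.pi * |w|)⁻¹)
      (.of_forall fun _ => norm_nonneg _) ?_ ?_
    · filter_upwards [eventually_gt_atTop 0] with R hR
      rw [norm_mul, norm_inv, Complex.norm_real, Real.norm_of_nonneg hR.le]
      gcongr
      exact norm_setIntegral_Icc_fourierChar_le hw (by linarith)
    · simpa using tendsto_inv_atTop_zero.mul_const (Real.pi * |w|)⁻¹

theorem setIntegral_box_prod (F : Fin m → ℝ → ℂ) (x : EuclideanSpace ℝ (Fin m)) (R : ℝ) :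
    ∫ t in box x R, ∏ i, F i (t i) = ∏ i, ∫ s in Set.Icc (x i) (x i + R), F i s := by
  rw [box_eq_preimage]
  refine ((EuclideanSpace.volume_preserving_symm_measurableEquiv_toLp
    (Fin m)).setIntegral_preimage_emb (MeasurableEquiv.measurableEmbedding _)
    (fun y : Fin m → ℝ => ∏ i, F i (y i)) _).trans ?_
  rw [volume_pi, Measure.restrict_pi_pi, integral_fintype_prod_eq_prod]

theorem hasMean_character (ω : EuclideanSpace ℝ (Fin m)) :
    HasMean (character ω) (if ω = 0 then 1 else 0) := by
  intro x
  have hprod : (∏ i, if ω i = 0 then (1 : ℂ) else 0) = if ω = 0 then 1 else 0 := by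
    rw [Finset.prod_ite_zero, Finset.prod_const_one]
    simp [PiLp.ext_iff]
  rw [← hprod]
  refine (tendsto_finsetProd Finset.univ
    fun i _ => tendsto_mean_fourierChar (ω i) (x i)).congr fun R => ?_
  rw [Finset.prod_mul_distrib, Finset.prod_const, Finset.card_univ, Fintype.card_fin, inv_pow,
    ← setIntegral_box_prod]
  simp only [character_eq_prod]

theorem norm_mean_le {F : EuclideanSpace ℝ (Fin m) → ℂ} {C : ℝ} (hF : ∀ t, ‖F t‖ ≤ C)
    (x : EuclideanSpace ℝ (Fin m)) {R : ℝ} (hR : 0 < R) :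
    ‖((R : ℂ) ^ m)⁻¹ * ∫ t in box x R, F t‖ ≤ C := by
  have hbound := norm_setIntegral_le_of_norm_le_const (volume_box_lt_top x R) fun t _ => hF t
  rw [Measure.real, volume_box, ENNReal.toReal_pow, ENNReal.toReal_ofReal hR.le] at hbound
  rw [norm_mul, norm_inv, norm_pow, Complex.norm_real, Real.norm_of_nonneg hR.le]
  rwa [inv_mul_le_iff₀ (by positivity), mul_comm]

variable {I : Type*} {a : I → ℂ}

theorem norm_mul_character (z : ℂ) (ω t : EuclideanSpace ℝ (Fin m)) :
    ‖z * character ω t‖ = ‖z‖ := by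
  rw [norm_mul, norm_character, mul_one]

theorem hasMean_tsum [Countable I] (ha : Summable fun i => ‖a i‖)
    (ν : I → EuclideanSpace ℝ (Fin m)) :
    HasMean (fun t => ∑' i, a i * character (ν i) t) (∑' i, a i * if ν i = 0 then 1 else 0) := by
  intro x
  have hswap (R : ℝ) : ((R : ℂ) ^ m)⁻¹ * ∫ t in box x R, ∑' i, a i * character (ν i) t
      = ∑' i, ((R : ℂ) ^ m)⁻¹ * ∫ t in box x R, a i * character (ν i) t := by
    have := isFiniteMeasure_restrict.2 (volume_box_lt_top x R).ne
    rw [tsum_mul_left, integral_tsum_of_summable_integral_norm]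
    · exact fun i => .of_bound (continuous_const.mul (continuous_character _)).aestronglyMeasurable
        ‖a i‖ (.of_forall fun t => (norm_mul_character _ _ _).le)
    · simp only [norm_mul_character, integral_const, smul_eq_mul]
      exact ha.mul_left _
  simp only [hswap]
  refine tendsto_tsum_of_dominated_convergence ha (fun i => ?_) ?_
  · refine ((hasMean_character (ν i) x).const_mul (a i)).congr fun R => ?_
    rw [integral_const_mul]
    ring
  · filter_upwards [eventually_gt_atTop 0] with R hR i
    exact norm_mean_le (fun t => (norm_mul_character _ _ _).le) x hR

theorem hasFourierCoeff_tsum [Countable I] (ha : Summable fun i => ‖a i‖)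
    (ν : I → EuclideanSpace ℝ (Fin m)) (ω : EuclideanSpace ℝ (Fin m)) :
    HasFourierCoeff (fun t => ∑' i, a i * character (-ν i) t) ω
      (∑' i, a i * if ν i = ω then 1 else 0) := by
  have h := hasMean_tsum ha fun i => -ν i + ω
  simp only [neg_add_eq_zero] at h
  refine fun x => (h x).congr fun R => ?_
  simp only [character_add_left, ← mul_assoc, tsum_mul_right]

theorem hasFourierCoeff_tsum_apply [Countable I] (ha : Summable fun i => ‖a i‖)
    {ν : I → EuclideanSpace ℝ (Fin m)} (hν : Function.Injective ν) (j : I) :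
    HasFourierCoeff (fun t => ∑' i, a i * character (-ν i) t) (ν j) (a j) := by
  convert hasFourierCoeff_tsum ha ν (ν j)
  rw [tsum_eq_single j fun i hi => by rw [if_neg (hν.ne hi), mul_zero], if_pos rfl, mul_one]

theorem hasFourierCoeff_tsum_of_notMem_range [Countable I] (ha : Summable fun i => ‖a i‖)
    {ν : I → EuclideanSpace ℝ (Fin m)} {ω : EuclideanSpace ℝ (Fin m)} (hω : ω ∉ Set.range ν) :
    HasFourierCoeff (fun t => ∑' i, a i * character (-ν i) t) ω 0 := by
  convert hasFourierCoeff_tsum ha ν ω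
  rw [eq_comm, tsum_congr fun i => by rw [if_neg fun h => hω ⟨i, h⟩, mul_zero], tsum_zero]

end Means

/-! ### Almost periodicity of trigonometric series -/

section AlmostPeriods

variable {m : ℕ}

theorem relativelyDense_of_finite {D s : Set (EuclideanSpace ℝ (Fin m))} (hs : s.Finite)
    (h : ∀ t, ∃ p ∈ s, t - p ∈ D) : RelativelyDense D := by
  obtain ⟨M, hM₀, hM⟩ := hs.isBounded.exists_pos_norm_le
  refine ⟨2 * M, by positivity, fun t => ?_⟩
  obtain ⟨p, hp, hpD⟩ := h (WithLp.toLp 2 fun i => t i + M)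
  refine ⟨_, hpD, fun i => ?_⟩
  have hpi := abs_le.1 ((PiLp.norm_apply_le p i).trans (hM p hp))
  simp only [PiLp.sub_apply]
  constructor <;> linarith [hpi.1, hpi.2]

-- Compactness of the torus `I → Circle` replaces a Diophantine argument: finitely many translates
-- of a neighbourhood of `1` cover the closure of the range of `t ↦ (e^{2πi ν_i·t})_i`.
theorem exists_finite_forall_tsum_character_sub_lt {I : Type*} {c : I → ℝ} (hc : Summable c)
    (hc₀ : ∀ i, 0 ≤ c i) (ν : I → EuclideanSpace ℝ (Fin m)) {ε : ℝ} (hε : 0 < ε) :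
    ∃ s : Set (EuclideanSpace ℝ (Fin m)), s.Finite ∧
      ∀ t, ∃ p ∈ s, ∑' i, c i * ‖character (ν i) (t - p) - 1‖ < ε := by
  let φ (t : EuclideanSpace ℝ (Fin m)) : I → Circle := fun i => 𝐞 (inner ℝ (ν i) t)
  let G (z : I → Circle) : ℝ := ∑' i, c i * ‖(z i : ℂ) - 1‖
  have hG : Continuous G := by
    refine continuous_tsum (fun i => by fun_prop) (hc.mul_right 2) fun i z => ?_
    rw [norm_mul, norm_norm, Real.norm_of_nonneg (hc₀ i)]
    refine mul_le_mul_of_nonneg_left ((norm_sub_le _ _).trans_eq ?_) (hc₀ i)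
    rw [Circle.norm_coe, norm_one, one_add_one_eq_two]
  have hopen (w : I → Circle) : IsOpen {z | G (z / w) < ε} :=
    isOpen_lt (hG.comp (continuous_id.div_const w)) continuous_const
  have hcover : closure (Set.range φ) ⊆ ⋃ p, {z | G (z / φ p) < ε} := by
    intro z hz
    have hz' : IsOpen {w | G (z / w) < ε} :=
      isOpen_lt (hG.comp (continuous_const.div' continuous_id)) continuous_const
    obtain ⟨_, hp, p, rfl⟩ := mem_closure_iff.1 hz _ hz' (by simpa [G] using hε)
    exact Set.mem_iUnion.2 ⟨p, hp⟩
  obtain ⟨s, hs⟩ := isClosed_closure.isCompact.elim_finite_subcover _ (fun p => hopen (φ p)) hcover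
  refine ⟨s, s.finite_toSet, fun t => ?_⟩
  obtain ⟨p, hp, hlt⟩ := Set.mem_iUnion₂.1 (hs (subset_closure ⟨t, rfl⟩))
  refine ⟨p, hp, ?_⟩
  simpa only [G, φ, Set.mem_ofPred_eq, Pi.div_apply, character_eq_fourierChar, inner_sub_right,
    AddChar.map_sub_eq_div] using hlt

theorem almostPeriodic_tsum {I : Type*} {a : I → ℂ} (ha : Summable fun i => ‖a i‖)
    (ν : I → EuclideanSpace ℝ (Fin m)) :
    AlmostPeriodic fun t => ∑' i, a i * character (ν i) t := by
  have hsum (t : EuclideanSpace ℝ (Fin m)) : Summable fun i => a i * character (ν i) t :=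
    .of_norm_bounded ha fun i => (norm_mul_character _ _ _).le
  refine ⟨continuous_tsum (fun i => continuous_const.mul (continuous_character _)) ha
      fun i t => (norm_mul_character _ _ _).le,
    ⟨∑' i, ‖a i‖, fun t => tsum_of_norm_bounded ha.hasSum fun i => (norm_mul_character _ _ _).le⟩,
    fun ε hε => ?_⟩
  obtain ⟨s, hs, hst⟩ := exists_finite_forall_tsum_character_sub_lt ha (fun _ => norm_nonneg _) ν hε
  refine ⟨{τ | ∑' i, ‖a i‖ * ‖character (ν i) τ - 1‖ < ε}, relativelyDense_of_finite hs hst,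
    fun τ hτ t => ?_⟩
  have hterm (i : I) : ‖a i * character (ν i) (t + τ) - a i * character (ν i) t‖
      = ‖a i‖ * ‖character (ν i) τ - 1‖ := by
    rw [character_add_right, ← mul_assoc, ← mul_sub_one, norm_mul, norm_mul_character]
  have hsub : Summable fun i => ‖a i‖ * ‖character (ν i) τ - 1‖ := by
    refine .of_nonneg_of_le (fun i => by positivity) (fun i => ?_) (ha.mul_right 2)
    gcongr
    refine (norm_sub_le _ _).trans_eq ?_
    rw [norm_character, norm_one, one_add_one_eq_two]
  rw [← (hsum _).tsum_sub (hsum _)]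
  exact (tsum_of_norm_bounded hsub.hasSum fun i => (hterm i).le).trans hτ.le

end AlmostPeriods

/-! ### Dual lattices in orthogonal sums -/

section ProductLattice

variable {V W : Type*} [NormedAddCommGroup V] [InnerProductSpace ℝ V] [NormedAddCommGroup W]
  [InnerProductSpace ℝ W]

/-- The inner product of the orthogonal sum of `V` and `W`, as a bilinear form on `V × W`, whose
norm is the maximum norm. -/
def prodInner : LinearMap.BilinForm ℝ (V × W) :=
  (innerₗ V).compl₁₂ (LinearMap.fst ℝ V W) (LinearMap.fst ℝ V W) +
    (innerₗ W).compl₁₂ (LinearMap.snd ℝ V W) (LinearMap.snd ℝ V W)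

theorem prodInner_apply (x y : V × W) :
    prodInner x y = inner ℝ x.1 y.1 + inner ℝ x.2 y.2 :=
  rfl

theorem prodInner_comm (x y : V × W) : prodInner x y = prodInner y x := by
  simp only [prodInner_apply, real_inner_comm x.1, real_inner_comm x.2]

theorem prodInner_nondegenerate :
    (prodInner : LinearMap.BilinForm ℝ (V × W)).Nondegenerate := by
  have hleft (x : V × W) (hx : ∀ y, prodInner x y = 0) : x = 0 := by
    refine Prod.ext (inner_self_eq_zero (𝕜 := ℝ).1 ?_) (inner_self_eq_zero (𝕜 := ℝ).1 ?_)
    · simpa [prodInner_apply] using hx (x.1, 0)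
    · simpa [prodInner_apply] using hx (0, x.2)
  exact ⟨hleft, fun y hy => hleft y fun x => prodInner_comm y x ▸ hy x⟩

theorem eq_zero_of_dense_of_inner_mem_range {D : Set W} (hD : Dense D) {w : W}
    (hw : ∀ s ∈ D, inner ℝ s w ∈ Set.range ((↑) : ℤ → ℝ)) : w = 0 := by
  by_contra hne
  have hcont : Continuous fun s : W => (inner ℝ s w : ℝ) := by fun_prop
  let s₀ : W := (2 * ‖w‖ ^ 2)⁻¹ • w
  have hs₀ : (inner ℝ s₀ w : ℝ) = 2⁻¹ := by
    have : ‖w‖ ≠ 0 := norm_ne_zero_iff.2 hne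
    simp only [s₀, inner_smul_left, conj_trivial, real_inner_self_eq_norm_sq]
    field_simp
  obtain ⟨s, ⟨h₀, h₁⟩, hs⟩ := hD.inter_open_nonempty _ (isOpen_Ioo.preimage hcont)
    ⟨s₀, show (inner ℝ s₀ w : ℝ) ∈ Set.Ioo 0 1 by rw [hs₀]; norm_num⟩
  obtain ⟨n, hn⟩ := hw s hs
  simp only [← hn] at h₀ h₁
  norm_cast at h₀ h₁
  omega

theorem fst_injective_dualSubmodule {Γ : Submodule ℤ (V × W)}
    (hΓ : Dense (Prod.snd '' (Γ : Set (V × W)))) :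
    Function.Injective fun η : prodInner.dualSubmodule Γ => (η : V × W).1 := by
  intro η η' h
  refine Subtype.ext (Prod.ext h (sub_eq_zero.1 (eq_zero_of_dense_of_inner_mem_range hΓ ?_)))
  rintro _ ⟨γ, hγ, rfl⟩
  obtain ⟨n, hn⟩ := Submodule.mem_one.1 ((η - η').2 γ hγ)
  refine ⟨n, hn.trans ?_⟩
  have hfst : (η : V × W).1 - (η' : V × W).1 = 0 := sub_eq_zero.2 h
  rw [prodInner_comm, prodInner_apply, Submodule.coe_sub, Prod.fst_sub, Prod.snd_sub, hfst,
    inner_zero_right, zero_add]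

end ProductLattice

theorem summable_indicator_snd {V W : Type*} [NormedAddCommGroup V] [NormedSpace ℝ V]
    [FiniteDimensional ℝ V] [NormedAddCommGroup W] [NormedSpace ℝ W] [FiniteDimensional ℝ W]
    (L : Submodule ℤ (V × W)) [DiscreteTopology L] {n : ℕ} (hn : finrank ℤ L < n) {a : W → ℝ}
    {C : ℝ} (ha₀ : ∀ w, 0 ≤ a w) (ha : ∀ w, a w ≤ C * ((1 + ‖w‖) ^ n)⁻¹) {R : ℝ} (hR : 0 ≤ R) :
    Summable fun η : L => {η : V × W | ‖η.1‖ ≤ R}.indicator (fun η => a η.2) η := by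
  have hC : 0 ≤ C := by simpa using (ha₀ 0).trans (ha 0)
  refine .of_nonneg_of_le (fun η => Set.indicator_nonneg (fun _ _ => ha₀ _) _) (fun η => ?_)
    ((summable_one_add_norm_pow_inv L hn).mul_left (C * (1 + R) ^ n))
  refine Set.indicator_apply_le' (fun hη => ?_) fun _ => by positivity
  have hnorm : 1 + ‖(η : V × W)‖ ≤ (1 + R) * (1 + ‖(η : V × W).2‖) := by
    have : ‖(η : V × W)‖ ≤ R + ‖(η : V × W).2‖ :=
      max_le (hη.trans (le_add_of_nonneg_right (norm_nonneg _))) (le_add_of_nonneg_left hR)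
    nlinarith [norm_nonneg (η : V × W).2]
  calc a (η : V × W).2 ≤ C * ((1 + ‖(η : V × W).2‖) ^ n)⁻¹ := ha _
    _ ≤ C * ((1 + R) ^ n * ((1 + ‖(η : V × W)‖) ^ n)⁻¹) := by
        gcongr
        exact inv_pow_le_pow_mul_inv_pow (by positivity) (by positivity) hnorm n
    _ = _ := (mul_assoc _ _ _).symm

section FourierDecay

variable {W : Type*} [NormedAddCommGroup W] [InnerProductSpace ℝ W] [FiniteDimensional ℝ W]
  [MeasurableSpace W] [BorelSpace W] {φ : W → ℂ}

theorem exists_norm_fourier_le (hφ : ContDiff ℝ ((⊤ : ℕ∞) : WithTop ℕ∞) φ)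
    (hφc : HasCompactSupport φ) (n : ℕ) :
    ∃ C : ℝ, ∀ w, ‖𝓕 φ w‖ ≤ C * ((1 + ‖w‖) ^ n)⁻¹ :=
  exists_schwartzMap_norm_le (𝓕 (hφc.toSchwartzMap hφ)) n

theorem summable_indicator_fourier_snd {V : Type*} [NormedAddCommGroup V] [NormedSpace ℝ V]
    [FiniteDimensional ℝ V] (L : Submodule ℤ (V × W)) [DiscreteTopology L]
    (hφ : ContDiff ℝ ((⊤ : ℕ∞) : WithTop ℕ∞) φ) (hφc : HasCompactSupport φ) {R : ℝ}
    (hR : 0 ≤ R) :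
    Summable fun η : L => {η : V × W | ‖η.1‖ ≤ R}.indicator (fun η => ‖𝓕 φ η.2‖) η := by
  obtain ⟨C, hC⟩ := exists_norm_fourier_le hφ hφc (finrank ℤ L + 1)
  exact summable_indicator_snd L (Nat.lt_succ_self _) (fun w => norm_nonneg _) hC hR

end FourierDecay

/-! ### Band-limited products on lattices -/

theorem norm_mul_conj_le (a b : ℂ) : ‖a * conj b‖ ≤ ‖a‖ ^ 2 + ‖b‖ ^ 2 := by
  rw [norm_mul, RCLike.norm_conj]
  nlinarith [sq_nonneg (‖a‖ - ‖b‖), sq_nonneg ‖a‖, sq_nonneg ‖b‖]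

section Spectrum

/-- An integrable and square integrable function that vanishes almost everywhere off `S`: the
Fourier transform of a band-limited function with spectrum in `S`. -/
structure IsSpectrumIn {V : Type*} [MeasureSpace V] (S : Set V) (u : V → ℂ) : Prop where
  integrable : Integrable u
  memLp : MemLp u 2
  ae_eq_zero : ∀ᵐ t, t ∉ S → u t = 0

theorem IsSpectrumIn.integrable_sq {V : Type*} [MeasureSpace V] {S : Set V} {u : V → ℂ}
    (hu : IsSpectrumIn S u) : Integrable fun t => ‖u t‖ ^ 2 :=
  hu.memLp.integrable_norm_pow two_ne_zero

variable {V : Type*} [NormedAddCommGroup V] [MeasureSpace V]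

/-- The correlation `∫ u(t) conj(v(t - ω)) dt`. -/
def correlation (u v : V → ℂ) (ω : V) : ℂ :=
  ∫ t, u t * conj (v (t - ω))

variable [BorelSpace V] [(volume : Measure V).IsAddRightInvariant] {S : Set V} {u v : V → ℂ}

theorem IsSpectrumIn.integrable_mul_conj (hu : IsSpectrumIn S u) (hv : IsSpectrumIn S v) (ω : V) :
    Integrable fun t => u t * conj (v (t - ω)) :=
  hu.memLp.integrable_mul
    (hv.memLp.comp_measurePreserving (measurePreserving_sub_right volume ω)).star

theorem IsSpectrumIn.integral_norm_mul_conj_le (hu : IsSpectrumIn S u) (hv : IsSpectrumIn S v)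
    (ω : V) : ∫ t, ‖u t * conj (v (t - ω))‖ ≤ (∫ t, ‖u t‖ ^ 2) + ∫ t, ‖v t‖ ^ 2 := by
  have hv' : Integrable fun t => ‖v (t - ω)‖ ^ 2 := hv.integrable_sq.comp_sub_right ω
  rw [← integral_sub_right_eq_self (fun t => ‖v t‖ ^ 2) ω, ← integral_add hu.integrable_sq hv']
  exact integral_mono (hu.integrable_mul_conj hv ω).norm (hu.integrable_sq.add hv')
    fun t => norm_mul_conj_le _ _

theorem IsSpectrumIn.norm_correlation_le (hu : IsSpectrumIn S u) (hv : IsSpectrumIn S v) (ω : V) :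
    ‖correlation u v ω‖ ≤ (∫ t, ‖u t‖ ^ 2) + ∫ t, ‖v t‖ ^ 2 :=
  (norm_integral_le_integral_norm _).trans (hu.integral_norm_mul_conj_le hv ω)

theorem IsSpectrumIn.correlation_eq_zero (hu : IsSpectrumIn S u) (hv : IsSpectrumIn S v)
    {r : ℝ} (hr : ∀ t ∈ S, ‖t‖ ≤ r) {ω : V} (hω : 2 * r < ‖ω‖) : correlation u v ω = 0 := by
  refine integral_eq_zero_of_ae ?_
  have hv' : ∀ᵐ t, t - ω ∉ S → v (t - ω) = 0 :=
    (measurePreserving_sub_right volume ω).quasiMeasurePreserving.ae hv.ae_eq_zero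
  filter_upwards [hu.ae_eq_zero, hv'] with t hu₀ hv₀
  by_cases ht : t ∈ S
  · have hS : t - ω ∉ S := fun hS => by
      have := norm_sub_le t (t - ω)
      rw [sub_sub_cancel] at this
      linarith [hr t ht, hr _ hS]
    simp [hv₀ hS]
  · simp [hu₀ ht]

end Spectrum

section BandProduct

variable {V W : Type*} [NormedAddCommGroup V] [InnerProductSpace ℝ V] [FiniteDimensional ℝ V]
  [MeasurableSpace V] [BorelSpace V]

/-- The weighted product `𝓕⁻ u · conj (𝓕⁻ v) ⊗ φ` of two band-limited functions on `V`, where `φ`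
is the weight on the internal space `W`. -/
def bandProduct (u v : V → ℂ) (φ : W → ℂ) (w : V × W) : ℂ :=
  𝓕⁻ u w.1 * conj (𝓕⁻ v w.1) * φ w.2

variable {S : Set V} {u v : V → ℂ} {φ : W → ℂ}

theorem IsSpectrumIn.continuous_fourierInv (hu : IsSpectrumIn S u) : Continuous (𝓕⁻ u) := by
  rw [funext (Real.fourierInv_eq_fourier_neg u)]
  exact (continuous_fourier hu.integrable).comp continuous_neg

theorem continuous_bandProduct [TopologicalSpace W] (hu : IsSpectrumIn S u)
    (hv : IsSpectrumIn S v) (hφ : Continuous φ) : Continuous (bandProduct u v φ) :=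
  ((hu.continuous_fourierInv.comp continuous_fst).mul
    (Complex.continuous_conj.comp (hv.continuous_fourierInv.comp continuous_fst))).mul
    (hφ.comp continuous_snd)

theorem exists_bandProduct_bound [NormedAddCommGroup W] [NormedSpace ℝ W] [FiniteDimensional ℝ W]
    (Γ : Submodule ℤ (V × W)) [DiscreteTopology Γ] [IsZLattice ℝ Γ] (hS : IsCompact S)
    (hφ : Continuous φ) (hφc : HasCompactSupport φ) {R : ℝ} (hR : 0 ≤ R) :
    ∃ M : ℝ, ∀ u v, IsSpectrumIn S u → IsSpectrumIn S v →
      ∃ c : Γ → ℝ, Summable c ∧ ∑' γ, c γ ≤ M * ((∫ t, ‖u t‖ ^ 2) + ∫ t, ‖v t‖ ^ 2) ∧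
        ∀ (γ : Γ) (w : V × W), ‖w‖ ≤ R → ‖bandProduct u v φ (w + γ)‖ ≤ c γ := by
  obtain ⟨s, hs₀, hs⟩ := hφc.isBounded.subset_closedBall_lt 0 0
  obtain ⟨P, hP⟩ := hφ.bounded_above_of_compact_support hφc
  have hP₀ : 0 ≤ P := (norm_nonneg _).trans (hP 0)
  obtain ⟨M, hM⟩ := exists_sampling_bound Γ hS hR hs₀.le
  refine ⟨M * P, fun u v hu hv => ?_⟩
  obtain ⟨cu, hcu₀, hcu, hcuM, hcu_le⟩ := hM u hu.integrable hu.memLp hu.ae_eq_zero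
  obtain ⟨cv, hcv₀, hcv, hcvM, hcv_le⟩ := hM v hv.integrable hv.memLp hv.ae_eq_zero
  refine ⟨fun γ => (cu γ + cv γ) * P, (hcu.add hcv).mul_right P, ?_, fun γ w hw => ?_⟩
  · rw [tsum_mul_right, hcu.tsum_add hcv]
    nlinarith
  have hc₀ : 0 ≤ cu γ + cv γ := add_nonneg (hcu₀ γ) (hcv₀ γ)
  by_cases hsupp : ‖(w + γ).2‖ ≤ s
  · rw [bandProduct, norm_mul]
    exact mul_le_mul ((norm_mul_conj_le _ _).trans
      (add_le_add (hcu_le γ w hw hsupp) (hcv_le γ w hw hsupp))) (hP _) (norm_nonneg _) hc₀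
  · have hzero : φ (w + γ).2 = 0 := image_eq_zero_of_notMem_tsupport fun h =>
      hsupp (mem_closedBall_zero_iff.1 (hs h))
    rw [bandProduct, hzero, mul_zero, norm_zero]
    positivity

theorem locallySummable_bandProduct [NormedAddCommGroup W] [NormedSpace ℝ W]
    [FiniteDimensional ℝ W] (Γ : Submodule ℤ (V × W)) [DiscreteTopology Γ] [IsZLattice ℝ Γ]
    (hS : IsCompact S) (hφ : Continuous φ) (hφc : HasCompactSupport φ) (hu : IsSpectrumIn S u)
    (hv : IsSpectrumIn S v) (x : V × W) :
    LocallySummable Γ fun w => bandProduct u v φ (w - x) := by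
  intro R
  obtain ⟨M, hM⟩ := exists_bandProduct_bound Γ hS hφ hφc (R := max R 0 + ‖x‖) (by positivity)
  obtain ⟨c, hc, -, hcF⟩ := hM u v hu hv
  refine ⟨c, hc, fun γ w hw => ?_⟩
  simp only [add_sub_right_comm w]
  exact hcF γ _ ((norm_sub_le _ _).trans (by gcongr; exact hw.trans (le_max_left _ _)))

end BandProduct

section BandCoeff

variable {V W : Type*} [NormedAddCommGroup V] [InnerProductSpace ℝ V] [FiniteDimensional ℝ V]
  [MeasurableSpace V] [BorelSpace V] [NormedAddCommGroup W] [InnerProductSpace ℝ W]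
  [FiniteDimensional ℝ W] [MeasurableSpace W] [BorelSpace W]

instance : (volume : Measure (V × W)).IsAddHaarMeasure :=
  Measure.volume_eq_prod V W ▸ inferInstance

/-- The coefficient of frequency `η` in the Fourier expansion of the periodization of
`bandProduct u v φ` over `Γ`. -/
def bandCoeff (Γ : Submodule ℤ (V × W)) (φ : W → ℂ) (u v : V → ℂ) (η : V × W) : ℂ :=
  ((ZLattice.covolume Γ volume : ℝ) : ℂ)⁻¹ * 𝓕 φ η.2 * correlation u v η.1

variable {S : Set V} {u v : V → ℂ} {φ : W → ℂ}

theorem integral_fourierChar_smul_bandProduct (hu : IsSpectrumIn S u) (hv : IsSpectrumIn S v)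
    (φ : W → ℂ) (x : V) (η : V × W) :
    ∫ w, 𝐞 (-prodInner η w) • bandProduct u v φ (w - (x, 0))
      = 𝓕 φ η.2 * correlation u v η.1 * 𝐞 (-inner ℝ η.1 x) := by
  let F : V → ℂ := fun y => 𝓕⁻ u y * conj (𝓕⁻ v y)
  have hsplit (w : V × W) : 𝐞 (-prodInner η w) • bandProduct u v φ (w - (x, 0))
      = (𝐞 (-inner ℝ w.1 η.1) • F (w.1 + -x)) * (𝐞 (-inner ℝ w.2 η.2) • φ w.2) := by
    rw [prodInner_apply, neg_add, AddChar.map_add_eq_mul, real_inner_comm w.1,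
      real_inner_comm w.2]
    simp only [bandProduct, F, Circle.smul_def, Circle.coe_mul, smul_eq_mul, Prod.fst_sub,
      Prod.snd_sub, sub_zero, ← sub_eq_add_neg]
    ring
  simp only [hsplit]
  rw [Measure.volume_eq_prod, integral_prod_mul (fun y => 𝐞 (-inner ℝ y η.1) • F (y + -x))
    (fun s => 𝐞 (-inner ℝ s η.2) • φ s), ← Real.fourier_eq φ,
    ← Real.fourier_eq (fun y => F (y + -x)),
    fourier_comp_add_right, fourier_mul_conj_fourierInv hu.integrable hu.memLp hv.integrable
      hv.memLp, inner_neg_left, real_inner_comm, Circle.smul_def, smul_eq_mul, correlation]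
  ring

variable (Γ : Submodule ℤ (V × W)) [DiscreteTopology Γ] [IsZLattice ℝ Γ]

theorem norm_bandCoeff_le (φ : W → ℂ) (hu : IsSpectrumIn S u) (hv : IsSpectrumIn S v) {r : ℝ}
    (hr : ∀ t ∈ S, ‖t‖ ≤ r) (η : V × W) :
    ‖bandCoeff Γ φ u v η‖ ≤ (ZLattice.covolume Γ volume)⁻¹ *
      {η : V × W | ‖η.1‖ ≤ 2 * r}.indicator (fun η => ‖𝓕 φ η.2‖) η *
        ((∫ t, ‖u t‖ ^ 2) + ∫ t, ‖v t‖ ^ 2) := by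
  have hc := ZLattice.covolume_pos Γ (volume : Measure (V × W))
  by_cases hη : ‖η.1‖ ≤ 2 * r
  · rw [Set.indicator_of_mem (by exact hη), bandCoeff, norm_mul, norm_mul, norm_inv,
      Complex.norm_real, Real.norm_of_nonneg hc.le]
    gcongr
    exact hu.norm_correlation_le hv _
  · rw [Set.indicator_of_notMem (by exact hη), bandCoeff,
      hu.correlation_eq_zero hv hr (not_le.1 hη)]
    simp

theorem exists_summable_bandCoeff_bound (hS : IsCompact S)
    (hφ : ContDiff ℝ ((⊤ : ℕ∞) : WithTop ℕ∞) φ) (hφc : HasCompactSupport φ) :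
    ∃ c : prodInner.dualSubmodule Γ → ℝ, (∀ η, 0 ≤ c η) ∧ Summable c ∧
      ∀ u v, IsSpectrumIn S u → IsSpectrumIn S v → ∀ η : prodInner.dualSubmodule Γ,
        ‖bandCoeff Γ φ u v η‖ ≤ c η * ((∫ t, ‖u t‖ ^ 2) + ∫ t, ‖v t‖ ^ 2) := by
  have : DiscreteTopology (prodInner.dualSubmodule Γ) :=
    discreteTopology_dualSubmodule prodInner_nondegenerate
  obtain ⟨r, hr₀, hr⟩ := hS.isBounded.subset_closedBall_lt 0 0
  have hsum := (summable_indicator_fourier_snd (prodInner.dualSubmodule Γ) hφ hφc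
    (R := 2 * r) (by positivity)).mul_left (ZLattice.covolume Γ (volume : Measure (V × W)))⁻¹
  have hcovol := ZLattice.covolume_pos Γ (volume : Measure (V × W))
  refine ⟨_, fun η => ?_, hsum, fun u v hu hv η =>
    norm_bandCoeff_le Γ φ hu hv (fun t ht => mem_closedBall_zero_iff.1 (hr ht)) η⟩
  exact mul_nonneg (inv_nonneg.2 hcovol.le) (Set.indicator_nonneg (fun _ _ => norm_nonneg _) _)

theorem hasSum_bandCoeff (hS : IsCompact S) (hφ : ContDiff ℝ ((⊤ : ℕ∞) : WithTop ℕ∞) φ)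
    (hφc : HasCompactSupport φ) (hu : IsSpectrumIn S u) (hv : IsSpectrumIn S v) (x : V) :
    HasSum (fun η : prodInner.dualSubmodule Γ =>
        bandCoeff Γ φ u v η * 𝐞 (-inner ℝ (η : V × W).1 x))
      (∑' γ : Γ, bandProduct u v φ ((γ : V × W) - (x, 0))) := by
  have hcovol := (ZLattice.covolume_pos Γ (volume : Measure (V × W))).ne'
  have hterm (η : prodInner.dualSubmodule Γ) : (ZLattice.covolume Γ volume)⁻¹ •
      ∫ w, 𝐞 (-prodInner (η : V × W) w) • bandProduct u v φ (w - (x, 0))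
      = bandCoeff Γ φ u v η * 𝐞 (-inner ℝ (η : V × W).1 x) := by
    rw [integral_fourierChar_smul_bandProduct hu hv, bandCoeff, Complex.real_smul,
      Complex.ofReal_inv]
    ring
  have hsum : Summable fun η : prodInner.dualSubmodule Γ =>
      bandCoeff Γ φ u v η * 𝐞 (-inner ℝ (η : V × W).1 x) := by
    obtain ⟨c, -, hc, hle⟩ := exists_summable_bandCoeff_bound Γ hS hφ hφc
    refine .of_norm_bounded (hc.mul_right ((∫ t, ‖u t‖ ^ 2) + ∫ t, ‖v t‖ ^ 2)) fun η => ?_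
    rw [norm_mul, Circle.norm_coe, mul_one]
    exact hle u v hu hv η
  simp only [← hterm] at hsum ⊢
  exact (locallySummable_bandProduct Γ hS hφ.continuous hφc hu hv (x, 0)).hasSum_poisson
    ((continuous_bandProduct hu hv hφ.continuous).comp (continuous_sub_right _))
    prodInner_nondegenerate volume (by
      simpa only [smul_inv_smul₀ hcovol] using hsum.const_smul (ZLattice.covolume Γ volume))

end BandCoeff

/-! ### Families of band-limited functions -/

/-- A family of functions `u k` with spectrum in `S` whose squared `L²` norms are summable. -/
structure IsSpectrumFamily {V K : Type*} [MeasureSpace V] (S : Set V) (u : K → V → ℂ) :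
    Prop where
  isSpectrumIn : ∀ k, IsSpectrumIn S (u k)
  summable_integral_sq : Summable fun k => ∫ t, ‖u k t‖ ^ 2

theorem hasSum_tsum_swap {ι κ : Type*} {F : ι × κ → ℂ} (hF : Summable F) :
    HasSum (fun i => ∑' k, F (i, k)) (∑' k, ∑' i, F (i, k)) := by
  rw [Summable.tsum_comm (f := fun i k => F (i, k)) hF]
  exact hF.prod.hasSum

section SpectrumFamily

variable {V K : Type*} {S : Set V} {u v : K → V → ℂ}

theorem IsSpectrumFamily.hasSum_correlation [NormedAddCommGroup V] [MeasureSpace V]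
    [BorelSpace V] [(volume : Measure V).IsAddRightInvariant] [Countable K]
    (hu : IsSpectrumFamily S u) (hv : IsSpectrumFamily S v) (ω : V) :
    HasSum (fun k => correlation (u k) (v k) ω) (∫ t, ∑' k, u k t * conj (v k (t - ω))) :=
  hasSum_integral_of_summable_integral_norm
    (fun k => (hu.isSpectrumIn k).integrable_mul_conj (hv.isSpectrumIn k) ω)
    (.of_nonneg_of_le (fun _ => integral_nonneg fun _ => norm_nonneg _)
      (fun k => (hu.isSpectrumIn k).integral_norm_mul_conj_le (hv.isSpectrumIn k) ω)
      (hu.summable_integral_sq.add hv.summable_integral_sq))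

variable {W : Type*} [NormedAddCommGroup V] [InnerProductSpace ℝ V] [FiniteDimensional ℝ V]
  [MeasurableSpace V] [BorelSpace V] [NormedAddCommGroup W]

theorem summable_bandProduct [NormedSpace ℝ W] [FiniteDimensional ℝ W]
    (Γ : Submodule ℤ (V × W)) [DiscreteTopology Γ] [IsZLattice ℝ Γ] (hS : IsCompact S)
    {φ : W → ℂ} (hφ : Continuous φ) (hφc : HasCompactSupport φ) (hu : IsSpectrumFamily S u)
    (hv : IsSpectrumFamily S v) (x : V × W) :
    Summable fun q : K × Γ => bandProduct (u q.1) (v q.1) φ ((q.2 : V × W) - x) := by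
  obtain ⟨M, hM⟩ := exists_bandProduct_bound Γ hS hφ hφc (norm_nonneg (-x))
  choose c hc hcM hle using fun k => hM (u k) (v k) (hu.isSpectrumIn k) (hv.isSpectrumIn k)
  have hle' (k : K) (γ : Γ) : ‖bandProduct (u k) (v k) φ ((γ : V × W) - x)‖ ≤ c k γ := by
    rw [sub_eq_neg_add]
    exact hle k γ _ le_rfl
  have hsum (k : K) : Summable fun γ : Γ => ‖bandProduct (u k) (v k) φ ((γ : V × W) - x)‖ :=
    .of_nonneg_of_le (fun _ => norm_nonneg _) (hle' k) (hc k)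
  refine .of_norm ((summable_prod_of_nonneg fun _ => norm_nonneg _).2 ⟨hsum, ?_⟩)
  exact .of_nonneg_of_le (fun k => tsum_nonneg fun _ => norm_nonneg _)
    (fun k => ((hsum k).tsum_le_tsum (hle' k) (hc k)).trans (hcM k))
    ((hu.summable_integral_sq.add hv.summable_integral_sq).mul_left M)

variable [InnerProductSpace ℝ W] [FiniteDimensional ℝ W] [MeasurableSpace W] [BorelSpace W]
  (Γ : Submodule ℤ (V × W)) [DiscreteTopology Γ] [IsZLattice ℝ Γ] {φ : W → ℂ}

theorem summable_bandCoeff (hS : IsCompact S) (hφ : ContDiff ℝ ((⊤ : ℕ∞) : WithTop ℕ∞) φ)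
    (hφc : HasCompactSupport φ) (hu : IsSpectrumFamily S u) (hv : IsSpectrumFamily S v) :
    Summable fun q : prodInner.dualSubmodule Γ × K => bandCoeff Γ φ (u q.2) (v q.2) q.1 := by
  obtain ⟨c, hc₀, hc, hle⟩ := exists_summable_bandCoeff_bound Γ hS hφ hφc
  refine .of_norm_bounded (hc.mul_of_nonneg
    (hu.summable_integral_sq.add hv.summable_integral_sq) hc₀ fun k => ?_)
    fun q => hle _ _ (hu.isSpectrumIn q.2) (hv.isSpectrumIn q.2) q.1
  exact add_nonneg (integral_nonneg fun _ => by positivity) (integral_nonneg fun _ => by positivity)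

theorem summable_norm_tsum_bandCoeff (hS : IsCompact S)
    (hφ : ContDiff ℝ ((⊤ : ℕ∞) : WithTop ℕ∞) φ) (hφc : HasCompactSupport φ)
    (hu : IsSpectrumFamily S u) (hv : IsSpectrumFamily S v) :
    Summable fun η : prodInner.dualSubmodule Γ => ‖∑' k, bandCoeff Γ φ (u k) (v k) η‖ := by
  have h := (summable_bandCoeff Γ hS hφ hφc hu hv).norm
  exact h.prod.of_nonneg_of_le (fun _ => norm_nonneg _) fun η =>
    norm_tsum_le_tsum_norm (h.prod_factor η)

theorem hasSum_tsum_bandCoeff (hS : IsCompact S) (hφ : ContDiff ℝ ((⊤ : ℕ∞) : WithTop ℕ∞) φ)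
    (hφc : HasCompactSupport φ) (hu : IsSpectrumFamily S u) (hv : IsSpectrumFamily S v) (x : V) :
    HasSum (fun η : prodInner.dualSubmodule Γ => (∑' k, bandCoeff Γ φ (u k) (v k) η) *
        𝐞 (-inner ℝ (η : V × W).1 x))
      (∑' k, ∑' γ : Γ, bandProduct (u k) (v k) φ ((γ : V × W) - (x, 0))) := by
  have hsum : Summable fun q : prodInner.dualSubmodule Γ × K =>
      bandCoeff Γ φ (u q.2) (v q.2) q.1 * 𝐞 (-inner ℝ (q.1 : V × W).1 x) :=
    .of_norm_bounded (summable_bandCoeff Γ hS hφ hφc hu hv).norm fun q => by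
      rw [norm_mul, Circle.norm_coe, mul_one]
  have h := hasSum_tsum_swap hsum
  simp only [tsum_mul_right] at h
  simpa only [fun k => (hasSum_bandCoeff Γ hS hφ hφc (hu.isSpectrumIn k)
    (hv.isSpectrumIn k) x).tsum_eq] using h

end SpectrumFamily

/-! ### Sampled correlations on model sets -/

section CrossSpectrum

variable {m : ℕ} {f : L2 m} {g : EuclideanSpace ℝ (Fin m) → ℂ}
  {S : Set (EuclideanSpace ℝ (Fin m))}

/-- The Fourier transform `f̂ · conj ĝ` of the cross-correlation of `f` and `g`. -/
def crossSpectrum (f : L2 m) (g : EuclideanSpace ℝ (Fin m) → ℂ)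
    (t : EuclideanSpace ℝ (Fin m)) : ℂ :=
  fourierL2 f t * conj (𝓕 g t)

theorem memLp_fourierL2 (f : L2 m) : MemLp (fourierL2 f) 2 := Lp.memLp _

theorem memLp_crossSpectrum (f : L2 m) (hg : Integrable g) : MemLp (crossSpectrum f g) 2 := by
  refine (memLp_fourierL2 f).of_le_mul (c := ∫ y, ‖g y‖) ((memLp_fourierL2 f).1.mul
    (Complex.continuous_conj.comp (continuous_fourier hg)).aestronglyMeasurable)
    (Eventually.of_forall fun t => ?_)
  rw [crossSpectrum, norm_mul, RCLike.norm_conj, mul_comm]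
  gcongr
  exact VectorFourier.norm_fourierIntegral_le_integral_norm _ _ _ _ _

theorem isSpectrumIn_crossSpectrum (hg : Integrable g) (hS : IsCompact S)
    (hf : ∀ᵐ t, t ∉ S → fourierL2 f t = 0) : IsSpectrumIn S (crossSpectrum f g) := by
  have hzero : ∀ᵐ t, t ∉ S → crossSpectrum f g t = 0 := by
    filter_upwards [hf] with t ht htS
    rw [crossSpectrum, ht htS, zero_mul]
  have : IsFiniteMeasure (volume.restrict S) := isFiniteMeasure_restrict.2 hS.measure_lt_top.ne
  have hint : IntegrableOn (crossSpectrum f g) S :=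
    ((memLp_crossSpectrum f hg).restrict S).integrable one_le_two
  exact ⟨hint.integrable_of_ae_notMem_eq_zero hzero, memLp_crossSpectrum f hg, hzero⟩

theorem l2Inner_translate (f : L2 m) (hg : Integrable g) (hg₂ : MemLp g 2)
    (x l : EuclideanSpace ℝ (Fin m)) :
    l2Inner (translate x f) (translate l g) = 𝓕⁻ (crossSpectrum f g) (l - x) := by
  calc l2Inner (translate x f) (translate l g)
      = ∫ t, f t * conj (g (t + (x - l))) := by
        rw [← integral_sub_right_eq_self (fun t => f t * conj (g (t + (x - l)))) x]
        simp only [l2Inner, translate, sub_add_sub_cancel]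
    _ = ∫ t, fourierL2 f t * conj (𝓕 (fun y => g (y + (x - l))) t) :=
        (integral_mul_conj_fourier_Lp f (hg.comp_add_right (x - l))
          (hg₂.comp_measurePreserving (measurePreserving_add_right volume (x - l)))).symm
    _ = 𝓕⁻ (crossSpectrum f g) (l - x) := by
        rw [Real.fourierInv_eq]
        refine integral_congr_ae (Eventually.of_forall fun t => ?_)
        simp only [fourier_comp_add_right, Circle.smul_def, smul_eq_mul, map_mul, crossSpectrum]
        rw [← Circle.coe_inv_eq_conj, ← AddChar.map_neg_eq_inv, ← inner_neg_left, neg_sub,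
          real_inner_comm]
        ring

theorem conj_l2Inner (F G : EuclideanSpace ℝ (Fin m) → ℂ) :
    conj (l2Inner F G) = l2Inner G F := by
  rw [l2Inner, l2Inner, ← integral_conj]
  simp only [map_mul, RCLike.conj_conj, mul_comm]

theorem coeffIntegrand_eq {K : Type*} (f : L2 m) (g h : K → EuclideanSpace ℝ (Fin m) → ℂ)
    (ω t : EuclideanSpace ℝ (Fin m)) :
    coeffIntegrand (fourierL2 f) g h ω t
      = ∑' k, crossSpectrum f (g k) t * conj (crossSpectrum f (h k) (t - ω)) := by
  rw [coeffIntegrand, ← tsum_mul_left]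
  refine tsum_congr fun k => ?_
  simp only [crossSpectrum, map_mul, RCLike.conj_conj]
  ring

end CrossSpectrum

section Generators

variable {m : ℕ} {K : Type*} {f : L2 m} {g h : K → EuclideanSpace ℝ (Fin m) → ℂ} {Bg Bh : ℝ}
  {S : Set (EuclideanSpace ℝ (Fin m))}

theorem isSpectrumFamily_crossSpectrum (hg : ∀ k, Integrable (g k))
    (hgB : ∀ t, Summable (fun k => ‖𝓕 (g k) t‖ ^ 2) ∧ ∑' k, ‖𝓕 (g k) t‖ ^ 2 ≤ Bg)
    (hS : IsCompact S) (hf : ∀ᵐ t, t ∉ S → fourierL2 f t = 0) :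
    IsSpectrumFamily S fun k => crossSpectrum f (g k) := by
  have hspec (k : K) := isSpectrumIn_crossSpectrum (hg k) hS hf
  refine ⟨hspec, summable_of_sum_le (c := ∫ t, ‖fourierL2 f t‖ ^ 2 * Bg)
    (fun k => integral_nonneg fun t => by positivity) fun s => ?_⟩
  rw [← integral_finsetSum _ fun k _ => (hspec k).integrable_sq]
  refine integral_mono (integrable_finsetSum _ fun k _ => (hspec k).integrable_sq)
    (((memLp_fourierL2 f).integrable_norm_pow two_ne_zero).mul_const Bg) fun t => ?_
  simp only [crossSpectrum, norm_mul, RCLike.norm_conj, mul_pow, ← Finset.mul_sum]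
  gcongr
  exact ((hgB t).1.sum_le_tsum s fun _ _ => by positivity).trans (hgB t).2

theorem norm_conj_mul_le (a b : ℂ) : ‖conj a * b‖ ≤ ‖a‖ ^ 2 + ‖b‖ ^ 2 := by
  rw [mul_comm, add_comm]
  exact norm_mul_conj_le b a

theorem summable_conj_mul {a b : K → ℂ} (ha : Summable fun k => ‖a k‖ ^ 2)
    (hb : Summable fun k => ‖b k‖ ^ 2) : Summable fun k => conj (a k) * b k :=
  .of_norm_bounded (ha.add hb) fun _ => norm_conj_mul_le _ _

theorem integrable_coeffIntegrand [Countable K] (hg : ∀ k, Integrable (g k))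
    (hh : ∀ k, Integrable (h k))
    (hgB : ∀ t, Summable (fun k => ‖𝓕 (g k) t‖ ^ 2) ∧ ∑' k, ‖𝓕 (g k) t‖ ^ 2 ≤ Bg)
    (hhB : ∀ t, Summable (fun k => ‖𝓕 (h k) t‖ ^ 2) ∧ ∑' k, ‖𝓕 (h k) t‖ ^ 2 ≤ Bh)
    (ω : EuclideanSpace ℝ (Fin m)) : Integrable (coeffIntegrand (fourierL2 f) g h ω) := by
  have hsum (t : EuclideanSpace ℝ (Fin m)) :
      Summable fun k => conj (𝓕 (g k) t) * 𝓕 (h k) (t - ω) :=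
    summable_conj_mul (hgB t).1 (hhB _).1
  have hbound (t : EuclideanSpace ℝ (Fin m)) :
      ‖∑' k, conj (𝓕 (g k) t) * 𝓕 (h k) (t - ω)‖ ≤ Bg + Bh :=
    (tsum_of_norm_bounded ((hgB t).1.hasSum.add (hhB (t - ω)).1.hasSum)
      fun k => norm_conj_mul_le _ _).trans (add_le_add (hgB t).2 (hhB _).2)
  have hmeas : AEStronglyMeasurable
      (fun t => ∑' k, conj (𝓕 (g k) t) * 𝓕 (h k) (t - ω)) volume := by
    refine aestronglyMeasurable_of_tendsto_ae atTop (fun s : Finset K => ?_)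
      (Eventually.of_forall fun t => (hsum t).hasSum)
    exact Continuous.aestronglyMeasurable <| continuous_finsetSum s fun k _ =>
      (Complex.continuous_conj.comp (continuous_fourier (hg k))).mul
        ((continuous_fourier (hh k)).comp (continuous_sub_right ω))
  have hshift : MemLp (fun t => conj (fourierL2 f (t - ω))) 2 :=
    ((memLp_fourierL2 f).comp_measurePreserving (measurePreserving_sub_right volume ω)).star
  exact ((memLp_fourierL2 f).integrable_mul hshift).mul_bdd hmeas (.of_forall hbound)

end Generators

section ModelSet

variable {m : ℕ} {Γ : Submodule ℤ (EuclideanSpace ℝ (Fin m) × ℝ)} {Ω : Set ℝ} {ψ : ℝ → ℝ}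

/-- The squared weight `ψ²` on the internal space, with values in `ℂ`. -/
def sqWeight (ψ : ℝ → ℝ) (s : ℝ) : ℂ := ((ψ s ^ 2 : ℝ) : ℂ)

theorem IsSmoothSupportedIn.contDiff_sqWeight (hψ : IsSmoothSupportedIn ψ Ω) :
    ContDiff ℝ ((⊤ : ℕ∞) : WithTop ℕ∞) (sqWeight ψ) :=
  Complex.ofRealCLM.contDiff.comp (hψ.contDiff.pow 2)

theorem IsSmoothSupportedIn.sqWeight_eq_zero (hψ : IsSmoothSupportedIn ψ Ω) {s : ℝ}
    (hs : s ∉ Ω) : sqWeight ψ s = 0 := by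
  rw [sqWeight, image_eq_zero_of_notMem_tsupport fun h => hs (hψ.tsupport_subset h)]
  simp

theorem IsSmoothSupportedIn.hasCompactSupport_sqWeight (hψ : IsSmoothSupportedIn ψ Ω)
    (hΩ : IsCompact Ω) : HasCompactSupport (sqWeight ψ) :=
  .intro hΩ fun _ hs => hψ.sqWeight_eq_zero hs

theorem weight_fst_of_injOn
    (hΓ : Set.InjOn Prod.fst (Γ : Set (EuclideanSpace ℝ (Fin m) × ℝ)))
    (ψ : ℝ → ℝ) {γ : EuclideanSpace ℝ (Fin m) × ℝ} (hγ : γ ∈ Γ) (hγΩ : γ.2 ∈ Ω) :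
    weight Γ Ω ψ γ.1 = ψ γ.2 := by
  have hl : γ.1 ∈ modelSet Γ Ω := ⟨γ, hγ, hγΩ, rfl⟩
  obtain ⟨hΓl, -, hfst⟩ := hl.choose_spec
  rw [weight, dif_pos hl, hΓ hΓl hγ hfst]

theorem exists_modelSet_lift (hΓ : Set.InjOn Prod.fst (Γ : Set (EuclideanSpace ℝ (Fin m) × ℝ)))
    (Ω : Set ℝ) :
    ∃ e : modelSet Γ Ω → Γ, Function.Injective e ∧
      (∀ l, (e l : EuclideanSpace ℝ (Fin m) × ℝ).1 = l) ∧
      ∀ γ : Γ, γ ∈ Set.range e ↔ (γ : EuclideanSpace ℝ (Fin m) × ℝ).2 ∈ Ω := by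
  choose e heΓ heΩ hfst using fun l : modelSet Γ Ω => l.2
  refine ⟨fun l => ⟨e l, heΓ l⟩, fun l l' h => Subtype.ext ?_, hfst, fun γ => ⟨?_, fun hγ => ?_⟩⟩
  · have hel : e l = e l' := congrArg Subtype.val h
    rw [← hfst l, ← hfst l', hel]
  · rintro ⟨l, rfl⟩
    exact heΩ l
  · exact ⟨⟨_, γ, γ.2, hγ, rfl⟩, Subtype.ext (hΓ (heΓ _) γ.2 (hfst _))⟩

theorem seriesTerm_fst (hΓ : Set.InjOn Prod.fst (Γ : Set (EuclideanSpace ℝ (Fin m) × ℝ)))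
    (ψ : ℝ → ℝ) (f : L2 m) {g h : EuclideanSpace ℝ (Fin m) → ℂ} (hg : Integrable g)
    (hg₂ : MemLp g 2) (hh : Integrable h) (hh₂ : MemLp h 2) (x : EuclideanSpace ℝ (Fin m))
    {γ : EuclideanSpace ℝ (Fin m) × ℝ} (hγ : γ ∈ Γ) (hγΩ : γ.2 ∈ Ω) :
    seriesTerm Γ Ω ψ f g h x γ.1
      = bandProduct (crossSpectrum f g) (crossSpectrum f h) (sqWeight ψ) (γ - (x, 0)) := by
  rw [seriesTerm, weight_fst_of_injOn hΓ ψ hγ hγΩ, ← conj_l2Inner (translate x f),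
    l2Inner_translate f hg hg₂, l2Inner_translate f hh hh₂, bandProduct, sqWeight,
    Prod.fst_sub, Prod.snd_sub, sub_zero]
  ring

theorem tsum_seriesTerm (hΓ : Set.InjOn Prod.fst (Γ : Set (EuclideanSpace ℝ (Fin m) × ℝ)))
    (hψ : IsSmoothSupportedIn ψ Ω) (f : L2 m) {g h : EuclideanSpace ℝ (Fin m) → ℂ}
    (hg : Integrable g) (hg₂ : MemLp g 2) (hh : Integrable h) (hh₂ : MemLp h 2)
    (x : EuclideanSpace ℝ (Fin m)) :
    ∑' l : modelSet Γ Ω, seriesTerm Γ Ω ψ f g h x l = ∑' γ : Γ, bandProduct (crossSpectrum f g)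
      (crossSpectrum f h) (sqWeight ψ) ((γ : EuclideanSpace ℝ (Fin m) × ℝ) - (x, 0)) := by
  obtain ⟨e, he, hfst, hrange⟩ := exists_modelSet_lift hΓ Ω
  have hterm (l : modelSet Γ Ω) := seriesTerm_fst hΓ ψ f hg hg₂ hh hh₂ x (e l).2
    ((hrange _).1 ⟨l, rfl⟩)
  simp only [hfst] at hterm
  rw [tsum_congr hterm]
  refine he.tsum_eq (f := fun γ : Γ => bandProduct (crossSpectrum f g) (crossSpectrum f h)
    (sqWeight ψ) ((γ : EuclideanSpace ℝ (Fin m) × ℝ) - (x, 0))) fun γ hγ => (hrange γ).2 ?_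
  by_contra hΩ
  refine hγ ?_
  simp only [bandProduct, Prod.snd_sub, sub_zero, hψ.sqWeight_eq_zero hΩ, mul_zero]

theorem dualLattice_eq (Γ : Submodule ℤ (EuclideanSpace ℝ (Fin m) × ℝ)) :
    dualLattice Γ = (prodInner.dualSubmodule Γ : Set (EuclideanSpace ℝ (Fin m) × ℝ)) := by
  ext η
  refine forall₂_congr fun γ _ => ?_
  rw [prodInner_comm, prodInner_apply, Submodule.mem_one]
  simp [eq_comm, mul_comm]

end ModelSet

section FourierSeries

variable {m : ℕ} {K : Type*} {Γ : Submodule ℤ (EuclideanSpace ℝ (Fin m) × ℝ)}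
  {Ω : Set ℝ} {ψ : ℝ → ℝ} {f : L2 m} {g h : K → EuclideanSpace ℝ (Fin m) → ℂ}
  {S : Set (EuclideanSpace ℝ (Fin m))}

theorem coeff_eq_tsum_bandCoeff [Countable K]
    (hu : IsSpectrumFamily S fun k => crossSpectrum f (g k))
    (hv : IsSpectrumFamily S fun k => crossSpectrum f (h k))
    (η : EuclideanSpace ℝ (Fin m) × ℝ) :
    coeff Γ ψ (fourierL2 f) g h η = ∑' k, bandCoeff Γ (sqWeight ψ) (crossSpectrum f (g k))
      (crossSpectrum f (h k)) η := by
  simp only [coeff, coeffIntegrand_eq, ← (hu.hasSum_correlation hv η.1).tsum_eq,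
    ← tsum_mul_left]
  rfl

variable [DiscreteTopology Γ] [IsZLattice ℝ Γ]

theorem summable_seriesTerm
    (hΓ : Set.InjOn Prod.fst (Γ : Set (EuclideanSpace ℝ (Fin m) × ℝ)))
    (hΩ : IsCompact Ω) (hψ : IsSmoothSupportedIn ψ Ω) (hg : ∀ k, Integrable (g k))
    (hg₂ : ∀ k, MemLp (g k) 2) (hh : ∀ k, Integrable (h k)) (hh₂ : ∀ k, MemLp (h k) 2)
    (hS : IsCompact S) (hu : IsSpectrumFamily S fun k => crossSpectrum f (g k))
    (hv : IsSpectrumFamily S fun k => crossSpectrum f (h k)) (x : EuclideanSpace ℝ (Fin m)) :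
    Summable fun q : K × modelSet Γ Ω => seriesTerm Γ Ω ψ f (g q.1) (h q.1) x q.2 := by
  obtain ⟨e, he, hfst, hrange⟩ := exists_modelSet_lift hΓ Ω
  refine ((summable_bandProduct Γ hS hψ.contDiff_sqWeight.continuous
    (hψ.hasCompactSupport_sqWeight hΩ) hu hv (x, 0)).comp_injective
    (Function.injective_id.prodMap he)).congr fun q => ?_
  rw [← hfst q.2, seriesTerm_fst hΓ ψ f (hg _) (hg₂ _) (hh _) (hh₂ _) x (e q.2).2
    ((hrange _).1 ⟨q.2, rfl⟩)]
  rfl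

theorem summable_norm_coeff [Countable K] (hΩ : IsCompact Ω) (hψ : IsSmoothSupportedIn ψ Ω)
    (hS : IsCompact S) (hu : IsSpectrumFamily S fun k => crossSpectrum f (g k))
    (hv : IsSpectrumFamily S fun k => crossSpectrum f (h k)) :
    Summable fun η : prodInner.dualSubmodule Γ => ‖coeff Γ ψ (fourierL2 f) g h η‖ := by
  simp only [coeff_eq_tsum_bandCoeff hu hv]
  exact summable_norm_tsum_bandCoeff Γ hS hψ.contDiff_sqWeight
    (hψ.hasCompactSupport_sqWeight hΩ) hu hv

theorem hasSum_coeff [Countable K]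
    (hΓ : Set.InjOn Prod.fst (Γ : Set (EuclideanSpace ℝ (Fin m) × ℝ)))
    (hΩ : IsCompact Ω) (hψ : IsSmoothSupportedIn ψ Ω) (hg : ∀ k, Integrable (g k))
    (hg₂ : ∀ k, MemLp (g k) 2) (hh : ∀ k, Integrable (h k)) (hh₂ : ∀ k, MemLp (h k) 2)
    (hS : IsCompact S) (hu : IsSpectrumFamily S fun k => crossSpectrum f (g k))
    (hv : IsSpectrumFamily S fun k => crossSpectrum f (h k)) (x : EuclideanSpace ℝ (Fin m)) :
    HasSum (fun η : prodInner.dualSubmodule Γ => coeff Γ ψ (fourierL2 f) g h η *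
        character (-(η : EuclideanSpace ℝ (Fin m) × ℝ).1) x)
      (weightedFun Γ Ω ψ f g h x) := by
  simp only [weightedFun, coeff_eq_tsum_bandCoeff hu hv, character_eq_fourierChar,
    inner_neg_left, fun k => tsum_seriesTerm hΓ hψ f (hg k) (hg₂ k) (hh k) (hh₂ k) x]
  exact hasSum_tsum_bandCoeff Γ hS hψ.contDiff_sqWeight (hψ.hasCompactSupport_sqWeight hΩ) hu hv x

end FourierSeries

end ModelSetFrames

end

open ModelSetFrames in
theorem proposition3p5_general {m : ℕ} {K : Type*} [Countable K]
    (Γ : Submodule ℤ (EuclideanSpace ℝ (Fin m) × ℝ)) [DiscreteTopology Γ] [IsZLattice ℝ Γ]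
    (hΓ : Set.InjOn Prod.fst (Γ : Set (EuclideanSpace ℝ (Fin m) × ℝ)))
    (hΓ' : Dense (Prod.snd '' (Γ : Set (EuclideanSpace ℝ (Fin m) × ℝ))))
    (Ω : Set ℝ) (hΩ : IsCompact Ω) (ψ : ℝ → ℝ) (hψ : IsSmoothSupportedIn ψ Ω)
    (g h : K → EuclideanSpace ℝ (Fin m) → ℂ)
    (hg : ∀ k, Integrable (g k)) (hg₂ : ∀ k, MemLp (g k) 2)
    (hh : ∀ k, Integrable (h k)) (hh₂ : ∀ k, MemLp (h k) 2) (Bg Bh : ℝ)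
    (hgB : ∀ t, Summable (fun k => ‖𝓕 (g k) t‖ ^ 2) ∧ ∑' k, ‖𝓕 (g k) t‖ ^ 2 ≤ Bg)
    (hhB : ∀ t, Summable (fun k => ‖𝓕 (h k) t‖ ^ 2) ∧ ∑' k, ‖𝓕 (h k) t‖ ^ 2 ≤ Bh)
    (f : L2 m) (hf : ∃ S, IsCompact S ∧ ∀ᵐ t, t ∉ S → fourierL2 f t = 0) :
    (∀ x, Summable (fun q : K × modelSet Γ Ω => seriesTerm Γ Ω ψ f (g q.1) (h q.1) x q.2)) ∧
    AlmostPeriodic (weightedFun Γ Ω ψ f g h) ∧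
    (∀ η ∈ dualLattice Γ,
      (∀ t, Summable (fun k => conj (𝓕 (g k) t) * 𝓕 (h k) (t - η.1))) ∧
      Integrable (coeffIntegrand (fourierL2 f) g h η.1) volume) ∧
    (∀ η ∈ dualLattice Γ,
      HasFourierCoeff (weightedFun Γ Ω ψ f g h) η.1 (coeff Γ ψ (fourierL2 f) g h η)) ∧
    (∀ ω, ω ∉ Prod.fst '' dualLattice Γ → HasFourierCoeff (weightedFun Γ Ω ψ f g h) ω 0) ∧
    (∀ x, HasSum
      (fun η : dualLattice Γ => coeff Γ ψ (fourierL2 f) g h η *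
        character (-(η : EuclideanSpace ℝ (Fin m) × ℝ).1) x)
      (weightedFun Γ Ω ψ f g h x)) := by
  obtain ⟨S, hS, hfS⟩ := hf
  have hu := isSpectrumFamily_crossSpectrum hg hgB hS hfS
  have hv := isSpectrumFamily_crossSpectrum hh hhB hS hfS
  have hcoeff := summable_norm_coeff (Γ := Γ) hΩ hψ hS hu hv
  have hseries := hasSum_coeff hΓ hΩ hψ hg hg₂ hh hh₂ hS hu hv
  have hN : weightedFun Γ Ω ψ f g h = fun x => ∑' η : prodInner.dualSubmodule Γ,
      coeff Γ ψ (fourierL2 f) g h η * character (-(η : EuclideanSpace ℝ (Fin m) × ℝ).1) x :=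
    funext fun x => (hseries x).tsum_eq.symm
  have := discreteTopology_dualSubmodule (L := Γ) prodInner_nondegenerate
  have : Countable (prodInner.dualSubmodule Γ) := countable_of_Lindelof_of_discrete
  rw [dualLattice_eq]
  refine ⟨summable_seriesTerm hΓ hΩ hψ hg hg₂ hh hh₂ hS hu hv, ?_,
    fun η _ => ⟨fun t => summable_conj_mul (hgB t).1 (hhB _).1,
      integrable_coeffIntegrand hg hh hgB hhB η.1⟩, fun η hη => ?_, fun ω hω => ?_, hseries⟩
  · exact hN ▸ almostPeriodic_tsum hcoeff fun η => -(η : EuclideanSpace ℝ (Fin m) × ℝ).1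
  · exact hN ▸ hasFourierCoeff_tsum_apply hcoeff (fst_injective_dualSubmodule hΓ') ⟨η, hη⟩
  · exact hN ▸ hasFourierCoeff_tsum_of_notMem_range hcoeff fun ⟨η, h⟩ => hω ⟨η, η.2, h⟩

open ModelSetFrames in
theorem proposition3p5 {m : ℕ} {K : Type*} [Countable K]
    (Γ : Submodule ℤ (EuclideanSpace ℝ (Fin m) × ℝ)) [DiscreteTopology Γ] [IsZLattice ℝ Γ]
    (hΓ : IsCutAndProject Γ)
    (Ω : Set ℝ) (hΩ : IsSymmetricSimpleWindow Ω)
    (ψ : ℝ → ℝ) (hψ : IsSmoothSupportedIn ψ Ω) (hψ_nonneg : ∀ s, 0 ≤ ψ s)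
    (g h : K → EuclideanSpace ℝ (Fin m) → ℂ)
    (hg : ∀ k, MemWiener 2 (g k)) (hh : ∀ k, MemWiener 2 (h k))
    (Bg Bh : ℝ) (hBg : 0 < Bg) (hBh : 0 < Bh)
    (hgB : ∀ t, Summable (fun k => ‖𝓕 (g k) t‖ ^ 2) ∧ ∑' k, ‖𝓕 (g k) t‖ ^ 2 ≤ Bg)
    (hhB : ∀ t, Summable (fun k => ‖𝓕 (h k) t‖ ^ 2) ∧ ∑' k, ‖𝓕 (h k) t‖ ^ 2 ≤ Bh)
    (f : L2 m) (hf : MemD f) :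
    -- the series defining the function converges absolutely at every point
    (∀ x, Summable (fun q : K × modelSet Γ Ω => seriesTerm Γ Ω ψ f (g q.1) (h q.1) x q.2)) ∧
    AlmostPeriodic (weightedFun Γ Ω ψ f g h) ∧
    -- the sums over `k` and the integrals in the coefficients converge absolutely
    (∀ η ∈ dualLattice Γ,
      (∀ t, Summable (fun k => conj (𝓕 (g k) t) * 𝓕 (h k) (t - η.1))) ∧
      Integrable
        (coeffIntegrand (fourierL2 f) g h η.1) volume) ∧
    -- `coeff` gives the Fourier coefficients, and there are no other frequencies
    (∀ η ∈ dualLattice Γ,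
      HasFourierCoeff (weightedFun Γ Ω ψ f g h) η.1
        (coeff Γ ψ (fourierL2 f) g h η)) ∧
    (∀ ω, ω ∉ Prod.fst '' dualLattice Γ →
      HasFourierCoeff (weightedFun Γ Ω ψ f g h) ω 0) ∧
    -- the function equals its Fourier series at every point
    (∀ x, HasSum
      (fun η : dualLattice Γ =>
        coeff Γ ψ (fourierL2 f) g h η *
          character (-(η : EuclideanSpace ℝ (Fin m) × ℝ).1) x)
      (weightedFun Γ Ω ψ f g h x)) :=
  proposition3p5_general Γ hΓ.injOn_fst hΓ.dense_snd Ω hΩ.isCompact ψ hψ g h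
    (fun k => (hg k).integrable one_le_two) (fun k => (hg k).memLp one_le_two ENNReal.ofNat_ne_top)
    (fun k => (hh k).integrable one_le_two) (fun k => (hh k).memLp one_le_two ENNReal.ofNat_ne_top)
    Bg Bh hgB hhB f hf.2
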